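/- Consider an RND-TTL cache with timer $T>0$, defined as follows. Events (requests) occur at the points of a Poisson process of rate $\Lambda>0$, and each event carries a random mark (such as the requested item and the outcomes of the random choices made at that request); marks are i.i.d. and independent of the event times. For every item $n$ of the catalog there are two measurable sets of marks, $I_n$ (insertion) and $R_n$ (refresh), which may overlap. If $n$ is not in the cache, the next event with mark in $I_n$ inserts it and sets its timer to $T$. If $n$ is in the cache, every event with mark in $R_n$ resets its timer to $T$. The item is evicted when its timer runs out. The initial timers are arbitrary deterministic values in $[0,T]$ ($0$ meaning that the item is not in the cache). The insertion rate $\lambda_n^i=\Lambda\,\mathbb P(\text{mark}\in I_n)$ and the refresh rate $\lambda_n^r=\Lambda\,\mathbb P(\text{mark}\in R_n)$ are the rates of the Poisson processes of events that insert $n$ when it is out of the cache, respectively refresh $n$ when it is in the cache. Let $n$ be an item with $\lambda_n^i>0$ and $\lambda_n^r>0$. Divide time into cycles: the first cycle starts at the first time at which $n$ is out of the cache, and every later cycle starts when $n$ is evicted. In any given cycle, let $T_n^{\mathrm{Off}}$ be the time from the start of the cycle until $n$ enters the cache and $T_n^{\mathrm{On}}$ the time from then until $n$ is next evicted. Then $T_n^{\mathrm{On}}$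 and $T_n^{\mathrm{Off}}$ are integrable, with $$\mathbb E[T_n^{\mathrm{On}}]=\frac{e^{\lambda_n^r T}-1}{\lambda_n^r},\qquad \mathbb E[T_n^{\mathrm{Off}}]=\frac1{\lambda_n^i},$$ and the steady-state occupancy of $n$ exists and equals $$o_n=\frac{\mathbb E[T_n^{\mathrm{On}}]}{\mathbb E[T_n^{\mathrm{Off}}]+\mathbb E[T_n^{\mathrm{On}}]},$$ that is, $\lim_{t\to\infty}\mathbb P(n\text{ is in the cache at time }t)=o_n$, and almost surely the fraction of the time interval $[0,t]$ during which $n$ is in the cache converges to $o_n$ as $t\to\infty$. -/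

import Mathlib

open MeasureTheory ProbabilityTheory Filter Topology

/-- An RND-TTL cache over the catalog `ι`, driven by a marked Poisson process on `(Ω, μ)`.

Events (requests) occur at the points of a Poisson process of rate `rate`, i.e. the inter-event
times `gap k` are i.i.d. exponential. The `k`-th event carries a mark `mark k` (for instance the
requested item together with the outcomes of all the random choices made at that request). The
pairs (inter-event time, mark) are i.i.d. and marks are independent of times.

Item `n` is inserted by an event whose mark lies in `insertOn n` if `n` is then out of the cache,
and its timer is refreshed by an event whose mark lies in `refreshOn n` if `n` is then in the
cache. `insertOn n` and `refreshOn n` may overlap, and may overlap with those of other items. -/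
structure RNDTTLCache (ι : Type*) {Ω : Type*} (E : Type*) [MeasurableSpace Ω]
    [MeasurableSpace E] (μ : Measure Ω) where
  /-- the value `T` to which timers are set -/
  T : ℝ
  T_pos : 0 < T
  /-- the timers at time `0`; the value `0` means that the item is not in the cache -/
  startTimer : ι → ℝ
  startTimer_nonneg : ∀ n, 0 ≤ startTimer n
  startTimer_le : ∀ n, startTimer n ≤ T
  /-- the total rate of events -/
  rate : ℝ
  rate_pos : 0 < rate
  /-- the common law of the marks -/
  markLaw : Measure E
  isProbabilityMeasure_markLaw : IsProbabilityMeasure markLaw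
  insertOn : ι → Set E
  measurableSet_insertOn : ∀ n, MeasurableSet (insertOn n)
  refreshOn : ι → Set E
  measurableSet_refreshOn : ∀ n, MeasurableSet (refreshOn n)
  gap : ℕ → Ω → ℝ
  measurable_gap : ∀ k, Measurable (gap k)
  mark : ℕ → Ω → E
  measurable_mark : ∀ k, Measurable (mark k)
  map_gap_mark : ∀ k,
    μ.map (fun ω => (gap k ω, mark k ω)) = (expMeasure rate).prod markLaw
  iIndepFun_gap_mark : iIndepFun (fun k ω => (gap k ω, mark k ω)) μ

namespace RNDTTLCache

noncomputable section

variable {ι E Ω : Type*} [MeasurableSpace Ω] [MeasurableSpace E] {μ : Measure Ω}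

/-- `λ_n^i`: the rate of the thinned Poisson process of events that insert `n` when it is out. -/
def insertionRate (C : RNDTTLCache ι E μ) (n : ι) : ℝ :=
  C.rate * C.markLaw.real (C.insertOn n)

/-- `λ_n^r`: the rate of the thinned Poisson process of events that refresh `n` when it is in. -/
def refreshRate (C : RNDTTLCache ι E μ) (n : ι) : ℝ :=
  C.rate * C.markLaw.real (C.refreshOn n)

/-- `eventTime 0 = 0`, and `eventTime (k + 1)` is the time of the event with index `k`
(which has inter-event time `gap k` and mark `mark k`). -/
def eventTime (C : RNDTTLCache ι E μ) (k : ℕ) (ω : Ω) : ℝ :=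
  ∑ j ∈ Finset.range k, C.gap j ω

open Classical in
/-- The remaining time on the timer of item `n` at `eventTime k`, just after the event there.
A timer that has run out by the time of an event means that the item is out of the cache. -/
def timer (C : RNDTTLCache ι E μ) (n : ι) : ℕ → Ω → ℝ
  | 0, _ => C.startTimer n
  | k + 1, ω =>
    if 0 < C.timer n k ω - C.gap k ω then
      if C.mark k ω ∈ C.refreshOn n then C.T else C.timer n k ω - C.gap k ω
    else
      if C.mark k ω ∈ C.insertOn n then C.T else 0

/-- The set of cached items at time `t ≥ 0`: those whose timer has not run out. -/
def content (C : RNDTTLCache ι E μ) (t : ℝ) (ω : Ω) : Set ι :=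
  {n | ∃ k, C.eventTime k ω ≤ t ∧ t < C.eventTime (k + 1) ω ∧
    0 < C.timer n k ω - (t - C.eventTime k ω)}

/-- The first time at or after `s` at which `n` is in the cache. -/
def nextIn (C : RNDTTLCache ι E μ) (n : ι) (s : ℝ) (ω : Ω) : ℝ :=
  sInf {t | s ≤ t ∧ n ∈ C.content t ω}

/-- The first time at or after `s` at which `n` is not in the cache. -/
def nextOut (C : RNDTTLCache ι E μ) (n : ι) (s : ℝ) (ω : Ω) : ℝ :=
  sInf {t | s ≤ t ∧ n ∉ C.content t ω}

/-- The start of the `j`-th renewal cycle of `n`. Cycle `0` starts at the first time at which `n`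
is out of the cache; a cycle ends, and the next one starts, when `n` is evicted. -/
def cycleStart (C : RNDTTLCache ι E μ) (n : ι) : ℕ → Ω → ℝ
  | 0, ω => C.nextOut n 0 ω
  | j + 1, ω => C.nextOut n (C.nextIn n (C.cycleStart n j ω) ω) ω

/-- The time at which `n` enters the cache in its `j`-th cycle. -/
def insertionTime (C : RNDTTLCache ι E μ) (n : ι) (j : ℕ) (ω : Ω) : ℝ :=
  C.nextIn n (C.cycleStart n j ω) ω

/-- `T_n^Off` in the `j`-th cycle: from the start of the cycle to the insertion. -/
def Toff (C : RNDTTLCache ι E μ) (n : ι) (j : ℕ) (ω : Ω) : ℝ :=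
  C.insertionTime n j ω - C.cycleStart n j ω

/-- `T_n^On` in the `j`-th cycle: from the insertion to the next eviction. -/
def Ton (C : RNDTTLCache ι E μ) (n : ι) (j : ℕ) (ω : Ω) : ℝ :=
  C.cycleStart n (j + 1) ω - C.insertionTime n j ω

/-- `o` is the steady-state occupancy of item `n`: the probability that `n` is in the cache at
time `t` tends to `o` as `t → ∞`, and almost surely so does the fraction of the time interval
`[0, t]` during which `n` is in the cache. -/
def IsSteadyStateOccupancy (C : RNDTTLCache ι E μ) (n : ι) (o : ℝ) : Prop :=
  Tendsto (fun t : ℝ => μ.real {ω | n ∈ C.content t ω}) atTop (𝓝 o) ∧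
  ∀ᵐ ω ∂μ, Tendsto
    (fun t : ℝ => volume.real {u | u ∈ Set.Icc 0 t ∧ n ∈ C.content u ω} / t) atTop (𝓝 o)

end

end RNDTTLCache

/-! Just after each event the timer of `n` is a Markov chain on $[0,T]$, driven by the i.i.d. pairs
(gap, mark). "Kill" this chain at the transition that inserts `n`. Between two insertions the item
is in the cache and then out of it, once each, so $T^{\mathrm{On}}$ and $T^{\mathrm{Off}}$ are total
rewards of the killed chain (`TTLChain.cached_of_killedAt`).

Means. The expected total reward is the bounded solution of a one-step equation
(`IIDSeq.lintegral_totalReward`), because killing has probability bounded below and survival decays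
geometrically. The solutions are explicit: the constant $1/\lambda^i$ for the off time, and
$\frac{e^{\lambda^r T}}{\lambda^r}(1-e^{-\lambda^r x})$ for the on time from timer $x$, evaluated at
$x=T$.

Fraction of time. By the strong Markov property (`IIDSeq.iid_totalReward_inter_afterKill`) the
driving sequence after an insertion is independent of the cycle reward and has its original law. A
strong law along iterates (`tendsto_birkhoff_of_indepFun`) gives the averages of on and off times
over cycles, and monotonicity interpolates between insertions (`tendsto_div_of_tendsto_cycles`).

Probability at time $t$. Let $p(t)$ be the probability of being cached. Conditioning on the first
event almost gives $p = e + (\text{exponential density}) * p$: the chain restarts from another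
timer, but an event-free period of length $T$ erases the initial timer. So $|e(t)|$ is at most the
tail of an integrable coupling time. For an exponential kernel the equation is solved by
$p(t)=e(t)+\int_0^t r\,e$, which converges (`exists_tendsto_of_exponential_renewal`). The limit must
be the almost sure fraction, by comparing averages over $[0,n]$ with Fubini
(`TTLChain.tendsto_cachedProb`). -/

namespace IIDSeq

open scoped ENNReal

noncomputable section

/-! ### Killed chains driven by a sequence: pathwise facts. -/

section Combinatorics

variable {X Z : Type*}

/-- Drop the first `k` terms of a sequence. -/
def shift (k : ℕ) (w : ℕ → Z) : ℕ → Z := fun i => w (i + k)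

/-- Prepend a term to a sequence. -/
def cons (z : Z) (w : ℕ → Z) : ℕ → Z
  | 0 => z
  | i + 1 => w i

@[simp] lemma cons_zero (z : Z) (w : ℕ → Z) : cons z w 0 = z := rfl

@[simp] lemma cons_succ (z : Z) (w : ℕ → Z) (i : ℕ) : cons z w (i + 1) = w i := rfl

@[simp] lemma shift_apply (k : ℕ) (w : ℕ → Z) (i : ℕ) : shift k w i = w (i + k) := rfl

@[simp] lemma shift_zero (w : ℕ → Z) : shift 0 w = w := rfl

lemma shift_succ (k : ℕ) (w : ℕ → Z) : shift (k + 1) w = shift k (shift 1 w) := by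
  ext i; simp [add_assoc]

@[simp] lemma shift_one_cons (z : Z) (w : ℕ → Z) : shift 1 (cons z w) = w := rfl

@[simp] lemma shift_succ_cons (k : ℕ) (z : Z) (w : ℕ → Z) :
    shift (k + 1) (cons z w) = shift k w := rfl

/-- The state after `k` steps of the recursion `x ↦ s x z` driven by the sequence `w`. -/
def state (s : X → Z → X) : ℕ → X → (ℕ → Z) → X
  | 0, x, _ => x
  | k + 1, x, w => state s k (s x (w 0)) (shift 1 w)

lemma state_succ (s : X → Z → X) (k : ℕ) (x : X) (w : ℕ → Z) :
    state s (k + 1) x w = s (state s k x w) (w k) := by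
  induction k generalizing x w with
  | zero => rfl
  | succ k ih => rw [state, ih]; rfl

/-- The chain started at `x` is not killed during the first `k` steps. -/
def Survives (s : X → Z → X) (K : Set (X × Z)) : ℕ → X → (ℕ → Z) → Prop
  | 0, _, _ => True
  | k + 1, x, w => (x, w 0) ∉ K ∧ Survives s K k (s x (w 0)) (shift 1 w)

/-- The chain started at `x` is killed at the step with index `k`, and not before. -/
def KilledAt (s : X → Z → X) (K : Set (X × Z)) : ℕ → X → (ℕ → Z) → Prop
  | 0, x, w => (x, w 0) ∈ K
  | k + 1, x, w => (x, w 0) ∉ K ∧ KilledAt s K k (s x (w 0)) (shift 1 w)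

lemma survives_or_killedAt (s : X → Z → X) (K : Set (X × Z)) (k : ℕ) (x : X) (w : ℕ → Z) :
    Survives s K k x w ∨ ∃ i, KilledAt s K i x w := by
  induction k generalizing x w with
  | zero => exact .inl trivial
  | succ k ih =>
    by_cases h : (x, w 0) ∈ K
    · exact .inr ⟨0, h⟩
    · rcases ih (s x (w 0)) (shift 1 w) with h' | ⟨i, hi⟩
      · exact .inl ⟨h, h'⟩
      · exact .inr ⟨i + 1, h, hi⟩

lemma KilledAt.unique {s : X → Z → X} {K : Set (X × Z)} {k l : ℕ} {x : X} {w : ℕ → Z}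
    (hk : KilledAt s K k x w) (hl : KilledAt s K l x w) : k = l := by
  induction k generalizing l x w with
  | zero =>
    cases l with
    | zero => rfl
    | succ l => exact absurd hk hl.1
  | succ k ih =>
    cases l with
    | zero => exact absurd hl hk.1
    | succ l => rw [ih hk.2 hl.2]

/-- The index of the step at which the chain is killed (`0` if it never is). -/
def killIndex (s : X → Z → X) (K : Set (X × Z)) (x : X) (w : ℕ → Z) : ℕ :=
  sInf {k | KilledAt s K k x w}

lemma KilledAt.killIndex_eq {s : X → Z → X} {K : Set (X × Z)} {k : ℕ} {x : X} {w : ℕ → Z}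
    (h : KilledAt s K k x w) : killIndex s K x w = k :=
  (Nat.sInf_mem (s := {k | KilledAt s K k x w}) ⟨k, h⟩ : KilledAt s K _ x w).unique h

/-- The total of the rewards `r` over the first `k` steps. -/
def partialReward (s : X → Z → X) (r : X → Z → ℝ) (k : ℕ) (x : X) (w : ℕ → Z) : ℝ :=
  ∑ i ∈ Finset.range k, r (state s i x w) (w i)

lemma partialReward_succ (s : X → Z → X) (r : X → Z → ℝ) (k : ℕ) (x : X) (w : ℕ → Z) :
    partialReward s r (k + 1) x w =
      r x (w 0) + partialReward s r k (s x (w 0)) (shift 1 w) := by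
  rw [partialReward, Finset.sum_range_succ', add_comm]; rfl

/-- The total of the rewards `r` up to and including the step at which the chain is killed. -/
def totalReward (s : X → Z → X) (K : Set (X × Z)) (r : X → Z → ℝ) (x : X) (w : ℕ → Z) : ℝ :=
  partialReward s r (killIndex s K x w + 1) x w

/-- What remains of the driving sequence after the step at which the chain is killed. -/
def afterKill (s : X → Z → X) (K : Set (X × Z)) (x : X) (w : ℕ → Z) : ℕ → Z :=
  shift (killIndex s K x w + 1) w

open Classical in
/-- The total reward over the first `k` steps, or until the chain is killed. -/
def truncReward (s : X → Z → X) (K : Set (X × Z)) (r : X → Z → ℝ) (φ : X → ℝ≥0∞) :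
    ℕ → X → (ℕ → Z) → ℝ≥0∞
  | 0, x, _ => φ x
  | k + 1, x, w => ENNReal.ofReal (r x (w 0)) +
      if (x, w 0) ∈ K then 0 else truncReward s K r φ k (s x (w 0)) (shift 1 w)

/-- Nonnegative rewards and terminal value `0` make the truncations increase with the horizon, as
monotone convergence requires. -/
lemma truncReward_zero_mono (s : X → Z → X) (K : Set (X × Z)) (r : X → Z → ℝ) (k : ℕ) (x : X)
    (w : ℕ → Z) : truncReward s K r 0 k x w ≤ truncReward s K r 0 (k + 1) x w := by
  induction k generalizing x w with
  | zero => simp [truncReward]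
  | succ k ih =>
    rw [truncReward, truncReward]
    split_ifs
    · exact le_rfl
    · gcongr; exact ih _ _

lemma truncReward_zero_le (s : X → Z → X) (K : Set (X × Z)) (r : X → Z → ℝ) (φ : X → ℝ≥0∞)
    (k : ℕ) (x : X) (w : ℕ → Z) : truncReward s K r 0 k x w ≤ truncReward s K r φ k x w := by
  induction k generalizing x w with
  | zero => simp [truncReward]
  | succ k ih =>
    rw [truncReward, truncReward]
    split_ifs
    · exact le_rfl
    · gcongr; exact ih _ _

/-- The terminal value `φ` is collected only by a path still alive at the horizon. -/
lemma truncReward_le (s : X → Z → X) (K : Set (X × Z)) (r : X → Z → ℝ) {φ : X → ℝ≥0∞} {M : ℝ≥0∞}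
    (hφ : ∀ x, φ x ≤ M) (k : ℕ) (x : X) (w : ℕ → Z) :
    truncReward s K r φ k x w ≤
      truncReward s K r 0 k x w + {w | Survives s K k x w}.indicator (fun _ => M) w := by
  induction k generalizing x w with
  | zero => simpa [truncReward, Survives] using hφ x
  | succ k ih =>
    rw [truncReward, truncReward]
    split_ifs with h
    · simp
    · rw [add_assoc]
      gcongr
      refine (ih _ _).trans_eq ?_
      by_cases hS : Survives s K k (s x (w 0)) (shift 1 w) <;> simp [Survives, h, hS]

/-- Once the horizon lies beyond the killing step, the terminal value plays no role. -/
lemma KilledAt.truncReward_eq {s : X → Z → X} {K : Set (X × Z)} {r : X → Z → ℝ}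
    (hr : ∀ x z, 0 ≤ r x z) {φ : X → ℝ≥0∞} {k : ℕ} {x : X} {w : ℕ → Z}
    (h : KilledAt s K k x w) (m : ℕ) :
    truncReward s K r φ (m + (k + 1)) x w = ENNReal.ofReal (totalReward s K r x w) := by
  rw [totalReward, h.killIndex_eq]
  induction k generalizing x w with
  | zero =>
    have h0 : (x, w 0) ∈ K := h
    rw [zero_add, truncReward, if_pos h0]
    simp [partialReward, state]
  | succ k ih =>
    rw [← add_assoc, truncReward, if_neg h.1, ih h.2, partialReward_succ _ _ (k + 1),
      ENNReal.ofReal_add (hr _ _)]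
    exact Finset.sum_nonneg fun i _ => hr _ _

/-- A set of sequences depends only on the first `k` terms. -/
def DependsOnFirst (k : ℕ) (A : Set (ℕ → Z)) : Prop :=
  ∀ w w' : ℕ → Z, (∀ i < k, w i = w' i) → (w ∈ A ↔ w' ∈ A)

lemma state_congr (s : X → Z → X) {k : ℕ} (x : X) {w w' : ℕ → Z} (h : ∀ i < k, w i = w' i) :
    state s k x w = state s k x w' := by
  induction k with
  | zero => rfl
  | succ k ih => rw [state_succ, state_succ, ih fun i hi => h i (by omega), h k (by omega)]

lemma partialReward_congr (s : X → Z → X) (r : X → Z → ℝ) {k : ℕ} (x : X) {w w' : ℕ → Z}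
    (h : ∀ i < k, w i = w' i) : partialReward s r k x w = partialReward s r k x w' := by
  refine Finset.sum_congr rfl fun i hi => ?_
  have hi := Finset.mem_range.1 hi
  rw [state_congr s x fun j hj => h j (hj.trans hi), h i hi]

lemma killedAt_congr (s : X → Z → X) (K : Set (X × Z)) {k : ℕ} (x : X) {w w' : ℕ → Z}
    (h : ∀ i < k + 1, w i = w' i) : KilledAt s K k x w ↔ KilledAt s K k x w' := by
  induction k generalizing x w w' with
  | zero => simp [KilledAt, h 0]
  | succ k ih =>
    rw [KilledAt, KilledAt, h 0 (by omega),
      ih (w := shift 1 w) (w' := shift 1 w') _ fun i hi => h (i + 1) (by omega)]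

end Combinatorics

/-! ### Measurability of the killed chain. -/

section Measurability

variable {X Z : Type*} [MeasurableSpace X] [MeasurableSpace Z]

@[fun_prop]
lemma measurable_shift (k : ℕ) : Measurable (shift k : (ℕ → Z) → ℕ → Z) := by
  unfold shift; fun_prop

lemma measurable_uncurry_cons :
    Measurable (fun p : Z × (ℕ → Z) => cons p.1 p.2) := by
  refine measurable_pi_iff.2 fun i => ?_
  cases i with
  | zero => exact measurable_fst
  | succ i => exact (measurable_pi_apply i).comp measurable_snd

lemma measurable_cons (z : Z) : Measurable (cons z : (ℕ → Z) → ℕ → Z) :=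
  measurable_uncurry_cons.comp measurable_prodMk_left

variable {s : X → Z → X} {K : Set (X × Z)} {r : X → Z → ℝ}

lemma measurable_first_step (hs : Measurable (Function.uncurry s)) :
    Measurable fun p : X × (ℕ → Z) => (s p.1 (p.2 0), shift 1 p.2) :=
  (hs.comp (measurable_fst.prodMk ((measurable_pi_apply 0).comp measurable_snd))).prodMk
    ((measurable_shift 1).comp measurable_snd)

lemma measurable_head : Measurable fun p : X × (ℕ → Z) => (p.1, p.2 0) :=
  measurable_fst.prodMk ((measurable_pi_apply 0).comp measurable_snd)

lemma measurable_state (hs : Measurable (Function.uncurry s)) (k : ℕ) :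
    Measurable fun p : X × (ℕ → Z) => state s k p.1 p.2 := by
  induction k with
  | zero => exact measurable_fst
  | succ k ih => exact ih.comp (measurable_first_step hs)

lemma measurableSet_survives (hs : Measurable (Function.uncurry s)) (hK : MeasurableSet K)
    (k : ℕ) : MeasurableSet {p : X × (ℕ → Z) | Survives s K k p.1 p.2} := by
  induction k with
  | zero => exact .univ
  | succ k ih => exact (measurable_head hK.compl).inter (measurable_first_step hs ih)

lemma measurableSet_killedAt (hs : Measurable (Function.uncurry s)) (hK : MeasurableSet K)
    (k : ℕ) : MeasurableSet {p : X × (ℕ → Z) | KilledAt s K k p.1 p.2} := by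
  induction k with
  | zero => exact measurable_head hK
  | succ k ih => exact (measurable_head hK.compl).inter (measurable_first_step hs ih)

lemma measurable_partialReward (hs : Measurable (Function.uncurry s))
    (hr : Measurable (Function.uncurry r)) (k : ℕ) :
    Measurable fun p : X × (ℕ → Z) => partialReward s r k p.1 p.2 :=
  Finset.measurable_sum _ fun i _ => hr.comp ((measurable_state hs i).prodMk
    ((measurable_pi_apply i).comp measurable_snd))

lemma measurable_truncReward (hs : Measurable (Function.uncurry s)) (hK : MeasurableSet K)
    (hr : Measurable (Function.uncurry r)) {φ : X → ℝ≥0∞} (hφ : Measurable φ) (k : ℕ) :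
    Measurable fun p : X × (ℕ → Z) => truncReward s K r φ k p.1 p.2 := by
  induction k with
  | zero => exact hφ.comp measurable_fst
  | succ k ih =>
    exact (hr.comp measurable_head).ennreal_ofReal.add
      (Measurable.ite (measurable_head hK) measurable_const (ih.comp (measurable_first_step hs)))

lemma measurable_killIndex (hs : Measurable (Function.uncurry s)) (hK : MeasurableSet K) (x : X) :
    Measurable (killIndex s K x) := by
  have hm : ∀ k, MeasurableSet {w | KilledAt s K k x w} := fun k =>
    measurable_prodMk_left (measurableSet_killedAt hs hK k)
  refine measurable_to_countable' fun k => ?_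
  -- Paths that are never killed have index `sInf ∅ = 0`, so they are added to the fibre over `0`.
  have : killIndex s K x ⁻¹' {k} = {w | KilledAt s K k x w} ∪
      ((⋃ i, {w | KilledAt s K i x w})ᶜ ∩ {_w | k = 0}) := by
    ext w
    by_cases h : ∃ i, KilledAt s K i x w
    · obtain ⟨i, hi⟩ := h
      have : ¬ ∀ i, ¬ KilledAt s K i x w := fun h => h i hi
      simp only [Set.mem_preimage, hi.killIndex_eq, Set.mem_singleton_iff, Set.mem_union,
        Set.mem_ofPred_eq, Set.mem_inter_iff, Set.mem_compl_iff, Set.mem_iUnion, not_exists, this,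
        false_and, or_false]
      exact ⟨fun e => e ▸ hi, fun h => hi.unique h⟩
    · have h0 : killIndex s K x w = 0 := by
        rw [killIndex, Set.eq_empty_of_forall_notMem (s := {k | KilledAt s K k x w})
          fun i hi => h ⟨i, hi⟩, Nat.sInf_empty]
      push Not at h
      simp [h0, h, eq_comm]
  rw [this]
  exact (hm k).union ((MeasurableSet.iUnion hm).compl.inter (.const _))

lemma measurable_totalReward (hs : Measurable (Function.uncurry s)) (hK : MeasurableSet K)
    (hr : Measurable (Function.uncurry r)) (x : X) : Measurable (totalReward s K r x) := by
  have : Measurable fun p : ℕ × (ℕ → Z) => partialReward s r (p.1 + 1) x p.2 :=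
    measurable_from_prod_countable_right fun k =>
      (measurable_partialReward hs hr (k + 1)).comp measurable_prodMk_left
  exact this.comp ((measurable_killIndex hs hK x).prodMk measurable_id)

lemma measurable_afterKill (hs : Measurable (Function.uncurry s)) (hK : MeasurableSet K) (x : X) :
    Measurable (afterKill s K x) := by
  have : Measurable fun p : ℕ × (ℕ → Z) => shift (p.1 + 1) p.2 :=
    measurable_from_prod_countable_right fun k => measurable_shift (k + 1)
  exact this.comp ((measurable_killIndex hs hK x).prodMk measurable_id)

end Measurability

/-! ### I.i.d. driving sequences: one-step equations and the strong Markov property. -/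

section IID

variable {X Z : Type*} [MeasurableSpace X] [MeasurableSpace Z] {ν : Measure Z}
  [IsProbabilityMeasure ν]

/-- The law of a sequence of independent random variables with common law `ν`. -/
abbrev iid (ν : Measure Z) [IsProbabilityMeasure ν] : Measure (ℕ → Z) :=
  Measure.infinitePi fun _ : ℕ => ν

variable (ν) in
lemma measurePreserving_cons :
    MeasurePreserving (fun p : Z × (ℕ → Z) => cons p.1 p.2) (ν.prod (iid ν)) (iid ν) := by
  refine ⟨measurable_uncurry_cons, Measure.eq_infinitePi _ fun S t ht => ?_⟩
  classical
  -- Pad the box with `univ` to an initial segment of indices, so that its first coordinate splits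
  -- off.
  obtain ⟨N, hN⟩ : ∃ N, S ⊆ Finset.range (N + 1) :=
    ⟨S.sup id, fun i hi => Finset.mem_range.2 (Nat.lt_succ_of_le (Finset.le_sup (f := id) hi))⟩
  set t' : ℕ → Set Z := fun i => if i ∈ S then t i else Set.univ with ht'
  have hm : ∀ i, MeasurableSet (t' i) := fun i => by
    simp only [ht']; split_ifs <;> [exact ht i; exact .univ]
  have h1 : (S : Set ℕ).pi t = (Finset.range (N + 1) : Set ℕ).pi t' := by
    ext w
    simp only [Set.mem_pi, Finset.mem_coe, ht']
    constructor
    · intro h i _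
      split_ifs with hi <;> [exact h i hi; trivial]
    · intro h i hi
      simpa [hi] using h i (hN hi)
  have h2 : (fun p : Z × (ℕ → Z) => cons p.1 p.2) ⁻¹' (Finset.range (N + 1) : Set ℕ).pi t' =
      t' 0 ×ˢ (Finset.range N : Set ℕ).pi fun i => t' (i + 1) := by
    ext ⟨z, w⟩
    simp only [Set.mem_preimage, Set.mem_pi, Finset.mem_coe, Finset.mem_range, Set.mem_prod]
    constructor
    · exact fun h => ⟨h 0 (by omega), fun i hi => h (i + 1) (by omega)⟩
    · rintro ⟨h0, h⟩ (_ | i) hi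
      · exact h0
      · exact h i (by omega)
  have h3 : ∏ i ∈ S, ν (t i) = ∏ i ∈ Finset.range (N + 1), ν (t' i) := by
    rw [← Finset.prod_subset hN (f := fun i => ν (t' i)) fun i _ hi => by simp [ht', hi]]
    exact Finset.prod_congr rfl fun i hi => by simp [ht', hi]
  rw [h1, h3, Measure.map_apply measurable_uncurry_cons
    (.pi (Finset.countable_toSet _) fun i _ => hm i), h2, Measure.prod_prod,
    Measure.infinitePi_pi _ fun i _ => hm (i + 1), Finset.prod_range_succ', mul_comm]

lemma lintegral_iid {F : (ℕ → Z) → ℝ≥0∞} (hF : Measurable F) :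
    ∫⁻ w, F w ∂iid ν = ∫⁻ z, ∫⁻ w, F (cons z w) ∂iid ν ∂ν := by
  rw [← (measurePreserving_cons ν).lintegral_comp hF,
    lintegral_prod (fun p : Z × (ℕ → Z) => F (cons p.1 p.2))
      (hF.comp measurable_uncurry_cons).aemeasurable]

lemma iid_apply {A : Set (ℕ → Z)} (hA : MeasurableSet A) :
    iid ν A = ∫⁻ z, iid ν {w | cons z w ∈ A} ∂ν := by
  rw [← lintegral_indicator_one hA, lintegral_iid (measurable_one.indicator hA)]
  refine lintegral_congr fun z => ?_
  exact lintegral_indicator_one (measurable_cons z hA)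

/-- The terms from index `k` on are independent of the first `k` terms, and distributed as the
whole sequence. -/
lemma iid_inter_shift {k : ℕ} {A S : Set (ℕ → Z)} (hA : MeasurableSet A)
    (hAk : DependsOnFirst k A) (hS : MeasurableSet S) :
    iid ν (A ∩ shift k ⁻¹' S) = iid ν A * iid ν S := by
  induction k generalizing A with
  | zero =>
    -- A set depending on no term at all is trivial.
    have : A = ∅ ∨ A = Set.univ := by
      rcases A.eq_empty_or_nonempty with h | ⟨w, hw⟩
      · exact .inl h
      · exact .inr (Set.eq_univ_of_forall fun w' => (hAk w w' (by simp)).1 hw)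
    have h0 : (shift 0 : (ℕ → Z) → ℕ → Z) ⁻¹' S = S := rfl
    rcases this with rfl | rfl <;> simp [h0]
  | succ k ih =>
    rw [iid_apply (hA.inter (measurable_shift _ hS)), iid_apply hA, ← lintegral_mul_const]
    · refine lintegral_congr fun z => ?_
      refine ih (measurable_cons z hA) fun w w' h => hAk _ _ fun i hi => ?_
      cases i with
      | zero => rfl
      | succ i => exact h i (by omega)
    · exact measurable_measure_prodMk_left (measurable_uncurry_cons hA)

lemma measurePreserving_shift (k : ℕ) :
    MeasurePreserving (shift k : (ℕ → Z) → ℕ → Z) (iid ν) (iid ν) := by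
  refine ⟨measurable_shift k, Measure.ext fun S hS => ?_⟩
  rw [Measure.map_apply (measurable_shift k) hS, ← Set.univ_inter (shift k ⁻¹' S),
    iid_inter_shift .univ (fun _ _ _ => Iff.rfl) hS, measure_univ, one_mul]

variable {s : X → Z → X} {K : Set (X × Z)} {r : X → Z → ℝ} {I : Set X}

/-- `I` is almost surely invariant and each step from it survives with probability at most `ρ`;
condition on the first step and induct. -/
lemma iid_survives_le (hs : Measurable (Function.uncurry s)) (hK : MeasurableSet K)
    (hI : ∀ x ∈ I, ∀ᵐ z ∂ν, s x z ∈ I) {ρ : ℝ≥0∞} (hρ : ∀ x ∈ I, ν {z | (x, z) ∉ K} ≤ ρ)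
    (k : ℕ) {x : X} (hx : x ∈ I) : iid ν {w | Survives s K k x w} ≤ ρ ^ k := by
  induction k generalizing x with
  | zero => simpa using prob_le_one
  | succ k ih =>
    rw [iid_apply (A := {w | Survives s K (k + 1) x w})
      (measurable_prodMk_left (measurableSet_survives hs hK (k + 1)))]
    have hKx : MeasurableSet {z | (x, z) ∉ K} := measurable_prodMk_left hK.compl
    calc _ ≤ ∫⁻ z, {z | (x, z) ∉ K}.indicator (fun _ => ρ ^ k) z ∂ν := by
          refine lintegral_mono_ae ?_
          filter_upwards [hI x hx] with z hz
          by_cases h : (x, z) ∈ K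
          · simp [Survives, h]
          · simpa [Survives, h] using ih hz
      _ = ρ ^ k * ν {z | (x, z) ∉ K} := lintegral_indicator_const hKx _
      _ ≤ ρ ^ (k + 1) := by rw [pow_succ]; gcongr; exact hρ x hx

lemma ae_exists_killedAt (hs : Measurable (Function.uncurry s)) (hK : MeasurableSet K)
    (hI : ∀ x ∈ I, ∀ᵐ z ∂ν, s x z ∈ I) {ρ : ℝ≥0∞} (hρ1 : ρ < 1)
    (hρ : ∀ x ∈ I, ν {z | (x, z) ∉ K} ≤ ρ) {x : X} (hx : x ∈ I) :
    ∀ᵐ w ∂iid ν, ∃ k, KilledAt s K k x w := by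
  refine le_antisymm (ge_of_tendsto' (ENNReal.tendsto_pow_atTop_nhds_zero_of_lt_one hρ1)
    fun k => (measure_mono fun w hw => ?_).trans (iid_survives_le hs hK hI hρ k hx)) zero_le
  exact (survives_or_killedAt s K k x w).resolve_right hw

/-- The one-step equation says that accumulated reward plus `φ` of the current state is a
martingale, so its mean does not depend on the horizon. -/
lemma lintegral_truncReward (hs : Measurable (Function.uncurry s)) (hK : MeasurableSet K)
    (hr : Measurable (Function.uncurry r)) (hI : ∀ x ∈ I, ∀ᵐ z ∂ν, s x z ∈ I) {φ : X → ℝ≥0∞}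
    (hφm : Measurable φ)
    (hφ : ∀ x ∈ I, ∫⁻ z, (ENNReal.ofReal (r x z) +
      {z | (x, z) ∉ K}.indicator (fun z => φ (s x z)) z) ∂ν = φ x)
    (k : ℕ) {x : X} (hx : x ∈ I) : ∫⁻ w, truncReward s K r φ k x w ∂iid ν = φ x := by
  induction k generalizing x with
  | zero => simp [truncReward]
  | succ k ih =>
    rw [lintegral_iid (F := fun w => truncReward s K r φ (k + 1) x w)
      ((measurable_truncReward hs hK hr hφm (k + 1)).comp measurable_prodMk_left), ← hφ x hx]
    refine lintegral_congr_ae ?_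
    filter_upwards [hI x hx] with z hz
    simp only [truncReward, cons_zero, shift_one_cons]
    rw [lintegral_add_left measurable_const, lintegral_const, measure_univ, mul_one]
    congr 1
    by_cases h : (x, z) ∈ K
    · simp [h]
    · simpa [h] using ih hz

/-- The expected total reward until killing is the bounded solution `φ` of the one-step
equation. -/
theorem lintegral_totalReward (hs : Measurable (Function.uncurry s)) (hK : MeasurableSet K)
    (hr : Measurable (Function.uncurry r)) (hr0 : ∀ x z, 0 ≤ r x z)
    (hI : ∀ x ∈ I, ∀ᵐ z ∂ν, s x z ∈ I) {ρ : ℝ≥0∞} (hρ1 : ρ < 1)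
    (hρ : ∀ x ∈ I, ν {z | (x, z) ∉ K} ≤ ρ) {φ : X → ℝ≥0∞} {M : ℝ≥0∞} (hM : M ≠ ∞)
    (hφM : ∀ x, φ x ≤ M) (hφm : Measurable φ)
    (hφ : ∀ x ∈ I, ∫⁻ z, (ENNReal.ofReal (r x z) +
      {z | (x, z) ∉ K}.indicator (fun z => φ (s x z)) z) ∂ν = φ x)
    {x : X} (hx : x ∈ I) : ∫⁻ w, ENNReal.ofReal (totalReward s K r x w) ∂iid ν = φ x := by
  have hm : ∀ k, Measurable fun w : ℕ → Z => truncReward s K r 0 k x w := fun k =>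
    (measurable_truncReward hs hK hr measurable_const k).comp measurable_prodMk_left
  have hlim : Tendsto (fun k => ∫⁻ w, truncReward s K r 0 k x w ∂iid ν) atTop
      (𝓝 (∫⁻ w, ENNReal.ofReal (totalReward s K r x w) ∂iid ν)) := by
    refine lintegral_tendsto_of_tendsto_of_monotone (fun k => (hm k).aemeasurable)
      (.of_forall fun w => monotone_nat_of_le_succ fun k => truncReward_zero_mono s K r k x w) ?_
    filter_upwards [ae_exists_killedAt hs hK hI hρ1 hρ hx] with w ⟨k, hk⟩
    exact (tendsto_add_atTop_iff_nat (k + 1)).1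
      (tendsto_const_nhds.congr fun m => (hk.truncReward_eq hr0 m).symm)
  -- Dropping the terminal value only decreases the truncated reward, which gives `≤`. Conversely it
  -- matters only on survival, so it contributes at most `M * ρ ^ k`, which tends to zero.
  refine le_antisymm (le_of_tendsto' hlim fun k => ?_) ?_
  · rw [← lintegral_truncReward hs hK hr hI hφm hφ k hx]
    exact lintegral_mono fun w => truncReward_zero_le s K r φ k x w
  · have hlim' := hlim.add (ENNReal.Tendsto.const_mul (a := M)
      (ENNReal.tendsto_pow_atTop_nhds_zero_of_lt_one hρ1) (.inr hM))
    rw [mul_zero, add_zero] at hlim'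
    refine ge_of_tendsto' hlim' fun k => ?_
    have hS : MeasurableSet {w | Survives s K k x w} :=
      measurable_prodMk_left (measurableSet_survives hs hK k)
    calc φ x = ∫⁻ w, truncReward s K r φ k x w ∂iid ν :=
          (lintegral_truncReward hs hK hr hI hφm hφ k hx).symm
      _ ≤ ∫⁻ w, (truncReward s K r 0 k x w +
            {w | Survives s K k x w}.indicator (fun _ => M) w) ∂iid ν :=
          lintegral_mono fun w => truncReward_le s K r hφM k x w
      _ = ∫⁻ w, truncReward s K r 0 k x w ∂iid ν + M * iid ν {w | Survives s K k x w} := by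
          rw [lintegral_add_left (hm k), lintegral_indicator_const hS]
      _ ≤ _ := by gcongr; exact iid_survives_le hs hK hI hρ k hx

/-- Strong Markov property: the sequence after the killing step is independent of the total
reward and distributed as the whole sequence. -/
theorem iid_totalReward_inter_afterKill (hs : Measurable (Function.uncurry s))
    (hK : MeasurableSet K) (hr : Measurable (Function.uncurry r)) {x : X}
    (hkill : ∀ᵐ w ∂iid ν, ∃ k, KilledAt s K k x w) {Q : Set ℝ} (hQ : MeasurableSet Q)
    {S : Set (ℕ → Z)} (hS : MeasurableSet S) :
    iid ν (totalReward s K r x ⁻¹' Q ∩ afterKill s K x ⁻¹' S) =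
      iid ν (totalReward s K r x ⁻¹' Q) * iid ν S := by
  -- Split according to the killing step: `A k` is decided by the first `k + 1` terms, hence
  -- independent of the terms that follow.
  set A : ℕ → Set (ℕ → Z) := fun k =>
    {w | KilledAt s K k x w} ∩ {w | partialReward s r (k + 1) x w ∈ Q} with hA
  have hAm : ∀ k, MeasurableSet (A k) := fun k =>
    (measurable_prodMk_left (measurableSet_killedAt hs hK k) :
      MeasurableSet {w | KilledAt s K k x w}).inter
      ((measurable_partialReward hs hr (k + 1)).comp measurable_prodMk_left hQ)
  have hAk : ∀ k, DependsOnFirst (k + 1) (A k) := fun k w w' h => by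
    simp only [hA, Set.mem_inter_iff, Set.mem_ofPred_eq]
    rw [killedAt_congr s K x h, partialReward_congr s r x h]
  have hdisj : Pairwise (Function.onFun Disjoint A) := fun i j hij =>
    Set.disjoint_left.2 fun w hi hj => hij (hi.1.unique hj.1)
  have h1 : (totalReward s K r x ⁻¹' Q : Set (ℕ → Z)) =ᵐ[iid ν] ⋃ k, A k := by
    refine eventuallyEq_set.2 ?_
    filter_upwards [hkill] with w ⟨k, hk⟩
    simp only [Set.mem_preimage, totalReward, hk.killIndex_eq, Set.mem_iUnion]
    exact ⟨fun h => ⟨k, hk, h⟩, fun ⟨i, hi, h⟩ => hi.unique hk ▸ h⟩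
  have h2 : (totalReward s K r x ⁻¹' Q ∩ afterKill s K x ⁻¹' S : Set (ℕ → Z)) =ᵐ[iid ν]
      ⋃ k, A k ∩ shift (k + 1) ⁻¹' S := by
    refine eventuallyEq_set.2 ?_
    filter_upwards [hkill] with w ⟨k, hk⟩
    simp only [Set.mem_inter_iff, Set.mem_preimage, totalReward, afterKill, hk.killIndex_eq,
      Set.mem_iUnion]
    exact ⟨fun h => ⟨k, ⟨hk, h.1⟩, h.2⟩, fun ⟨i, ⟨hi, h⟩, h'⟩ => hi.unique hk ▸ ⟨h, h'⟩⟩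
  rw [measure_congr h1, measure_congr h2, measure_iUnion hdisj hAm, measure_iUnion
    (hdisj.mono fun i j h => h.mono Set.inter_subset_left Set.inter_subset_left)
    fun k => (hAm k).inter (measurable_shift _ hS), ← ENNReal.tsum_mul_right]
  exact tsum_congr fun k => iid_inter_shift (hAm k) (hAk k) hS

lemma measurePreserving_afterKill (hs : Measurable (Function.uncurry s))
    (hK : MeasurableSet K) {x : X} (hkill : ∀ᵐ w ∂iid ν, ∃ k, KilledAt s K k x w) :
    MeasurePreserving (afterKill s K x) (iid ν) (iid ν) := by
  refine ⟨measurable_afterKill hs hK x, Measure.ext fun S hS => ?_⟩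
  -- With the reward unconstrained, the strong Markov identity reduces to the law of the remaining
  -- sequence.
  have := iid_totalReward_inter_afterKill (r := fun _ _ => 0) hs hK measurable_const hkill .univ hS
  rw [Measure.map_apply (measurable_afterKill hs hK x) hS, ← Set.univ_inter (afterKill s K x ⁻¹' S),
    ← Set.preimage_univ (f := totalReward s K (fun _ _ => 0) x), this, Set.preimage_univ,
    measure_univ, one_mul]

lemma indepFun_totalReward_afterKill (hs : Measurable (Function.uncurry s))
    (hK : MeasurableSet K) (hr : Measurable (Function.uncurry r)) {x : X}
    (hkill : ∀ᵐ w ∂iid ν, ∃ k, KilledAt s K k x w) :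
    IndepFun (totalReward s K r x) (afterKill s K x) (iid ν) := by
  refine indepFun_iff_measure_inter_preimage_eq_mul.2 fun Q S hQ hS => ?_
  rw [iid_totalReward_inter_afterKill hs hK hr hkill hQ hS,
    (measurePreserving_afterKill hs hK hkill).measure_preimage hS.nullMeasurableSet]

end IID

end

end IIDSeq

/-! ### A strong law of large numbers along iterates. -/

open scoped ENNReal

/-- Strong law of large numbers along a measure-preserving map `θ` which is independent of the
observable `Φ`. -/
theorem tendsto_birkhoff_of_indepFun {W : Type*} [MeasurableSpace W] {P : Measure W}
    [IsProbabilityMeasure P] {θ : W → W} (hθ : MeasurePreserving θ P P) {Φ : W → ℝ}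
    (hΦ : Measurable Φ) (hint : Integrable Φ P) (hind : IndepFun Φ θ P) :
    ∀ᵐ w ∂P, Tendsto (fun n : ℕ => (∑ i ∈ Finset.range n, Φ (θ^[i] w)) / n) atTop
      (𝓝 (∫ w, Φ w ∂P)) := by
  have hlt : ∀ i j, i < j → IndepFun (fun w => Φ (θ^[i] w)) (fun w => Φ (θ^[j] w)) P := by
    intro i j hij
    obtain ⟨k, rfl⟩ := Nat.exists_eq_add_of_lt hij
    have hΦk : Measurable fun w => Φ (θ^[k] w) := hΦ.comp (hθ.measurable.iterate k)
    have h0 : IndepFun Φ ((fun w => Φ (θ^[k] w)) ∘ θ) P := hind.comp measurable_id hΦk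
    refine indepFun_iff_measure_inter_preimage_eq_mul.2 fun A B hA hB => ?_
    have h1 := indepFun_iff_measure_inter_preimage_eq_mul.1 h0 A B hA hB
    have hA' := hΦ hA
    have hB' := (hΦk.comp hθ.measurable) hB
    -- `θ^[i]` preserves `P`, so independence of the observables at times `0` and `k + 1` passes to
    -- times `i` and `i + k + 1`.
    rw [← (hθ.iterate i).measure_preimage (hA'.inter hB').nullMeasurableSet,
      ← (hθ.iterate i).measure_preimage hA'.nullMeasurableSet,
      ← (hθ.iterate i).measure_preimage hB'.nullMeasurableSet] at h1
    have e : ∀ w, θ^[i + k + 1] w = θ^[k] (θ (θ^[i] w)) := fun w => by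
      rw [← Function.iterate_succ_apply, ← Function.iterate_add_apply]; congr 1; omega
    simp only [e]
    exact h1
  -- This strong law asks only for pairwise independence, which is what `hlt` supplies.
  refine strong_law_ae_real (fun i w => Φ (θ^[i] w)) hint ?_ ?_
  · intro i j hij
    rcases lt_or_gt_of_ne hij with h | h
    · exact hlt i j h
    · exact (hlt j i h).symm
  · intro i
    refine ⟨(hΦ.comp (hθ.iterate i).measurable).aemeasurable, hΦ.aemeasurable, ?_⟩
    change P.map (Φ ∘ θ^[i]) = P.map Φ
    rw [← Measure.map_map hΦ (hθ.iterate i).measurable, (hθ.iterate i).map_eq]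

/-! ### Integrals against the exponential law. -/

section Exponential

open Set

lemma expMeasure_eq_withDensity (r : ℝ) :
    expMeasure r = volume.withDensity (exponentialPDF r) := rfl

lemma lintegral_expMeasure (r : ℝ) {F : ℝ → ℝ≥0∞} (hF : Measurable F) :
    ∫⁻ g, F g ∂expMeasure r =
      ∫⁻ g in Ioi 0, ENNReal.ofReal (r * Real.exp (-(r * g))) * F g := by
  have hm : Measurable (exponentialPDF r) := (measurable_exponentialPDFReal r).ennreal_ofReal
  rw [expMeasure_eq_withDensity, lintegral_withDensity_eq_lintegral_mul _ hm hF,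
    ← lintegral_add_compl _ measurableSet_Ioi (A := Ioi (0 : ℝ)), compl_Ioi,
    setLIntegral_congr Iio_ae_eq_Iic.symm]
  rw [setLIntegral_congr_fun (g := fun _ => 0) measurableSet_Iio, lintegral_zero, add_zero]
  · refine setLIntegral_congr_fun measurableSet_Ioi fun g hg => ?_
    simp only [Pi.mul_apply, exponentialPDF_of_nonneg (le_of_lt hg)]
  · intro g hg
    simp only [Pi.mul_apply, exponentialPDF_of_neg hg, zero_mul]

lemma ae_pos_expMeasure (r : ℝ) : ∀ᵐ g ∂expMeasure r, 0 < g := by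
  have h : expMeasure r (Iic 0) = 0 := by
    rw [← lintegral_indicator_one measurableSet_Iic,
      lintegral_expMeasure r (measurable_one.indicator measurableSet_Iic),
      setLIntegral_congr_fun (g := fun _ => 0) measurableSet_Ioi, lintegral_zero]
    intro g hg
    have : g ∉ Iic (0 : ℝ) := by simpa using hg
    simp [this]
  filter_upwards [measure_eq_zero_iff_ae_notMem.1 h] with g hg using not_le.1 hg

instance nullSingletonClass_expMeasure (r : ℝ) : NullSingletonClass (expMeasure r) where
  measure_singleton x := by
    rw [expMeasure_eq_withDensity]
    exact withDensity_absolutelyContinuous _ _ (measure_singleton x)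

/-- Expectation of `h` on the event `g < x` under the exponential law, from an antiderivative. -/
lemma lintegral_expMeasure_Iio {r : ℝ} (hr : 0 < r) {x : ℝ} (hx : 0 ≤ x) {h Ψ : ℝ → ℝ}
    (hh : Continuous h) (h0 : ∀ g ∈ Ioo 0 x, 0 ≤ h g)
    (hΨ : ∀ g, HasDerivAt Ψ (r * Real.exp (-(r * g)) * h g) g) :
    ∫⁻ g, (Iio x).indicator (fun g => ENNReal.ofReal (h g)) g ∂expMeasure r =
      ENNReal.ofReal (Ψ x - Ψ 0) := by
  have hc : Continuous fun g => r * Real.exp (-(r * g)) * h g := by fun_prop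
  rw [lintegral_expMeasure r (hh.measurable.ennreal_ofReal.indicator measurableSet_Iio)]
  have e : ∀ g, ENNReal.ofReal (r * Real.exp (-(r * g))) *
      (Iio x).indicator (fun g => ENNReal.ofReal (h g)) g =
      (Iio x).indicator (fun g => ENNReal.ofReal (r * Real.exp (-(r * g)) * h g)) g := fun g => by
    by_cases hg : g ∈ Iio x
    · rw [indicator_of_mem hg, indicator_of_mem hg, ENNReal.ofReal_mul (mul_nonneg hr.le (Real.exp_nonneg _))]
    · rw [indicator_of_notMem hg, indicator_of_notMem hg, mul_zero]
  simp only [e]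
  rw [lintegral_indicator measurableSet_Iio, Measure.restrict_restrict measurableSet_Iio,
    Iio_inter_Ioi, ← intervalIntegral.integral_eq_sub_of_hasDerivAt (fun g _ => hΨ g)
      (hc.intervalIntegrable 0 x), intervalIntegral.integral_of_le hx,
    integral_Ioc_eq_integral_Ioo, ofReal_integral_eq_lintegral_ofReal]
  · exact (hc.integrableOn_Icc (a := 0) (b := x)).mono_set Ioo_subset_Icc_self
  · exact (ae_restrict_iff' measurableSet_Ioo).2
      (.of_forall fun g hg => mul_nonneg (by positivity) (h0 g hg))

/-- Expectation of `h` on the event `x ≤ g` under the exponential law, from an antiderivative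
vanishing at infinity. -/
lemma lintegral_expMeasure_Ici {r : ℝ} (hr : 0 < r) {x : ℝ} (hx : 0 ≤ x) {h Ψ : ℝ → ℝ}
    (hh : Continuous h) (h0 : ∀ g ∈ Ioi x, 0 ≤ h g)
    (hΨ : ∀ g, HasDerivAt Ψ (r * Real.exp (-(r * g)) * h g) g) (hlim : Tendsto Ψ atTop (𝓝 0)) :
    ∫⁻ g, (Ici x).indicator (fun g => ENNReal.ofReal (h g)) g ∂expMeasure r =
      ENNReal.ofReal (-Ψ x) := by
  have hpos : ∀ g ∈ Ioi x, 0 ≤ r * Real.exp (-(r * g)) * h g := fun g hg =>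
    mul_nonneg (by positivity) (h0 g hg)
  -- The exponential law has no atoms, so the endpoint can be dropped.
  have hae : (Ici x : Set ℝ) =ᵐ[expMeasure r] Ioi x := Ioi_ae_eq_Ici.symm
  rw [lintegral_congr_ae (g := (Ioi x).indicator fun g => ENNReal.ofReal (h g))
    (indicator_ae_eq_of_ae_eq_set hae),
    lintegral_expMeasure r (hh.measurable.ennreal_ofReal.indicator measurableSet_Ioi)]
  have e : ∀ g, ENNReal.ofReal (r * Real.exp (-(r * g))) *
      (Ioi x).indicator (fun g => ENNReal.ofReal (h g)) g =
      (Ioi x).indicator (fun g => ENNReal.ofReal (r * Real.exp (-(r * g)) * h g)) g := fun g => by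
    by_cases hg : g ∈ Ioi x
    · rw [indicator_of_mem hg, indicator_of_mem hg, ENNReal.ofReal_mul (mul_nonneg hr.le (Real.exp_nonneg _))]
    · rw [indicator_of_notMem hg, indicator_of_notMem hg, mul_zero]
  simp only [e]
  have hsub : Ioi x ∩ Ioi 0 = Ioi x := inter_eq_left.2 (Ioi_subset_Ioi hx)
  rw [lintegral_indicator measurableSet_Ioi, Measure.restrict_restrict measurableSet_Ioi, hsub,
    ← zero_sub, ← integral_Ioi_of_hasDerivAt_of_nonneg' (fun g _ => hΨ g) hpos hlim,
    ofReal_integral_eq_lintegral_ofReal]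
  · exact integrableOn_Ioi_deriv_of_nonneg' (fun g _ => hΨ g) hpos hlim
  · exact (ae_restrict_iff' measurableSet_Ioi).2 (.of_forall hpos)

lemma hasDerivAt_exp_neg_mul (r g : ℝ) :
    HasDerivAt (fun g => Real.exp (-(r * g))) (-(r * Real.exp (-(r * g)))) g := by
  have := (((hasDerivAt_id g).const_mul r).neg).exp
  refine this.congr_deriv ?_
  simp [mul_comm]

lemma tendsto_exp_neg_mul {r : ℝ} (hr : 0 < r) :
    Tendsto (fun g => Real.exp (-(r * g))) atTop (𝓝 0) :=
  Real.tendsto_exp_neg_atTop_nhds_zero.comp (tendsto_id.const_mul_atTop hr)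

lemma lintegral_expMeasure_Ici_const {r : ℝ} (hr : 0 < r) {x : ℝ} (hx : 0 ≤ x) {c : ℝ}
    (hc : 0 ≤ c) :
    ∫⁻ g, (Ici x).indicator (fun _ => ENNReal.ofReal c) g ∂expMeasure r =
      ENNReal.ofReal (c * Real.exp (-(r * x))) := by
  have hΨ : ∀ g, HasDerivAt (fun g => -c * Real.exp (-(r * g)))
      (r * Real.exp (-(r * g)) * c) g := fun g =>
    ((hasDerivAt_exp_neg_mul r g).const_mul (-c)).congr_deriv (by ring)
  rw [lintegral_expMeasure_Ici hr hx (h := fun _ => c) continuous_const (fun _ _ => hc) hΨ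
    (by simpa using (tendsto_exp_neg_mul hr).const_mul (-c))]
  ring_nf

lemma expMeasure_Ici {r : ℝ} (hr : 0 < r) {x : ℝ} (hx : 0 ≤ x) :
    expMeasure r (Ici x) = ENNReal.ofReal (Real.exp (-(r * x))) := by
  have := lintegral_expMeasure_Ici_const hr hx (c := 1) zero_le_one
  rw [one_mul, ENNReal.ofReal_one] at this
  rw [← this, ← lintegral_indicator_one measurableSet_Ici]; rfl

/-- Mean excess of an exponential random variable over `x`. -/
lemma lintegral_expMeasure_sub {r : ℝ} (hr : 0 < r) {x : ℝ} (hx : 0 ≤ x) :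
    ∫⁻ g, ENNReal.ofReal (g - x) ∂expMeasure r =
      ENNReal.ofReal (Real.exp (-(r * x)) / r) := by
  have e : ∀ g, ENNReal.ofReal (g - x) =
      (Ici x).indicator (fun g => ENNReal.ofReal (g - x)) g := fun g => by
    by_cases hg : x ≤ g
    · rw [indicator_of_mem (mem_Ici.2 hg)]
    · rw [indicator_of_notMem (by simpa using hg), ENNReal.ofReal_of_nonpos (by linarith)]
  have hΨ : ∀ g, HasDerivAt (fun g => -(g - x + 1 / r) * Real.exp (-(r * g)))
      (r * Real.exp (-(r * g)) * (g - x)) g := fun g => by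
    have h1 : HasDerivAt (fun g : ℝ => -(g - x + 1 / r)) (-1) g :=
      (((hasDerivAt_id g).sub_const x).add_const (1 / r)).neg
    refine (h1.mul (hasDerivAt_exp_neg_mul r g)).congr_deriv ?_
    field_simp
    ring
  have hlim : Tendsto (fun g => -(g - x + 1 / r) * Real.exp (-(r * g))) atTop (𝓝 0) := by
    have h1 : Tendsto (fun g => r⁻¹ * ((r * g) ^ 1 * Real.exp (-(r * g)))) atTop (𝓝 (r⁻¹ * 0)) :=
      ((Real.tendsto_pow_mul_exp_neg_atTop_nhds_zero 1).comp
        (tendsto_id.const_mul_atTop hr)).const_mul _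
    have h2 := (h1.add ((tendsto_exp_neg_mul hr).const_mul (-x + 1 / r))).neg
    simp only [mul_zero, add_zero, neg_zero] at h2
    refine h2.congr fun g => ?_
    field_simp
    ring
  rw [lintegral_congr e, lintegral_expMeasure_Ici hr hx (h := fun g => g - x) (by fun_prop)
    (fun g hg => sub_nonneg.2 (le_of_lt hg)) hΨ hlim]
  simp [div_eq_inv_mul]

end Exponential

/-! ### The timer as a killed chain, and its one-step expectations. -/

namespace TTLChain

open scoped ENNReal
open IIDSeq

noncomputable section

variable {E : Type*}

open Classical in
/-- One step of the timer of an item: `x` is the timer just after an event, and `z` consists of the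
time until the next event and its mark. -/
def step (T : ℝ) (R I : Set E) (x : ℝ) (z : ℝ × E) : ℝ :=
  if 0 < x - z.1 then (if z.2 ∈ R then T else x - z.1) else (if z.2 ∈ I then T else 0)

/-- The transitions at which the item is inserted. -/
def insertion (I : Set E) : Set (ℝ × (ℝ × E)) := {p | ¬ 0 < p.1 - p.2.1 ∧ p.2.2 ∈ I}

/-- The time in the cache between two events. -/
def onReward (x : ℝ) (z : ℝ × E) : ℝ := max (min z.1 x) 0

/-- The time out of the cache between two events. -/
def offReward (x : ℝ) (z : ℝ × E) : ℝ := max (z.1 - x) 0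

section Measurability

variable [MeasurableSpace E] {T : ℝ} {R I : Set E}

lemma measurable_step (hR : MeasurableSet R) (hI : MeasurableSet I) :
    Measurable (Function.uncurry (step T R I)) := by
  have h1 : Measurable fun p : ℝ × (ℝ × E) => p.1 - p.2.1 := by fun_prop
  have h2 : Measurable fun p : ℝ × (ℝ × E) => p.2.2 := by fun_prop
  exact Measurable.ite (h1 measurableSet_Ioi) (Measurable.ite (h2 hR) measurable_const h1)
    (Measurable.ite (h2 hI) measurable_const measurable_const)

lemma measurableSet_insertion (hI : MeasurableSet I) : MeasurableSet (insertion I) := by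
  have h1 : Measurable fun p : ℝ × (ℝ × E) => p.1 - p.2.1 := by fun_prop
  have h2 : Measurable fun p : ℝ × (ℝ × E) => p.2.2 := by fun_prop
  exact (h1 measurableSet_Ioi).compl.inter (h2 hI)

lemma measurable_onReward : Measurable (Function.uncurry (onReward (E := E))) := by
  unfold onReward Function.uncurry; fun_prop

lemma measurable_offReward : Measurable (Function.uncurry (offReward (E := E))) := by
  unfold offReward Function.uncurry; fun_prop

end Measurability

/-- The outer `max` with `0` in the rewards gives nonnegativity for every argument, including the
null set of negative gaps; `lintegral_totalReward` requires this. -/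
lemma onReward_nonneg (x : ℝ) (z : ℝ × E) : 0 ≤ onReward x z := le_max_right _ _

lemma offReward_nonneg (x : ℝ) (z : ℝ × E) : 0 ≤ offReward x z := le_max_right _ _

lemma onReward_add_offReward {x : ℝ} {z : ℝ × E} (hx : 0 ≤ x) (hz : 0 ≤ z.1) :
    onReward x z + offReward x z = z.1 := by
  unfold onReward offReward
  rcases le_total z.1 x with h | h
  · rw [min_eq_left h, max_eq_left hz, max_eq_right (by linarith), add_zero]
  · rw [min_eq_right h, max_eq_left hx, max_eq_left (by linarith)]; ring

lemma step_mem_Icc {T : ℝ} (hT : 0 ≤ T) (R I : Set E) {x : ℝ} (hx : x ∈ Set.Icc 0 T) {z : ℝ × E}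
    (hz : 0 ≤ z.1) : step T R I x z ∈ Set.Icc 0 T := by
  unfold step
  have := hx.2
  split_ifs <;> constructor <;> linarith

section Expectation

variable [MeasurableSpace E] {T r : ℝ} {m : Measure E} [IsProbabilityMeasure m] {R I : Set E}

lemma ae_pos_fst (r : ℝ) (m : Measure E) [IsProbabilityMeasure m] :
    ∀ᵐ z ∂(expMeasure r).prod m, 0 < z.1 :=
  Measure.quasiMeasurePreserving_fst.ae (ae_pos_expMeasure r)

lemma ae_step_mem_Icc (hT : 0 ≤ T) {x : ℝ} (hx : x ∈ Set.Icc 0 T) :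
    ∀ᵐ z ∂(expMeasure r).prod m, step T R I x z ∈ Set.Icc 0 T := by
  filter_upwards [ae_pos_fst r m] with z hz using step_mem_Icc hT R I hx hz.le

lemma prod_insertion (hr : 0 < r) {x : ℝ} (hx : 0 ≤ x) :
    (expMeasure r).prod m {z | (x, z) ∈ insertion I} =
      ENNReal.ofReal (m.real I * Real.exp (-(r * x))) := by
  have e : {z : ℝ × E | (x, z) ∈ insertion I} = Set.Ici x ×ˢ I := by
    ext z; simp [insertion]
  have := isProbabilityMeasure_expMeasure hr
  rw [e, Measure.prod_prod, expMeasure_Ici hr hx, mul_comm,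
    ENNReal.ofReal_mul measureReal_nonneg, ofReal_measureReal]

lemma prod_notMem_insertion (hr : 0 < r) (hI : MeasurableSet I) {x : ℝ} (hx : 0 ≤ x) :
    (expMeasure r).prod m {z | (x, z) ∉ insertion I} =
      ENNReal.ofReal (1 - m.real I * Real.exp (-(r * x))) := by
  have := isProbabilityMeasure_expMeasure hr
  have h : MeasurableSet {z : ℝ × E | (x, z) ∈ insertion I} :=
    measurable_prodMk_left (measurableSet_insertion hI)
  have e := prob_compl_eq_one_sub (μ := (expMeasure r).prod m) h
  rw [prod_insertion hr hx, ← ENNReal.ofReal_one, ← ENNReal.ofReal_sub _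
    (mul_nonneg measureReal_nonneg (Real.exp_nonneg _))] at e
  exact e

/-- Insertion needs a gap of at least `x`, so it is least likely from the full timer `x = T`; this
yields the uniform survival bound. -/
lemma prod_notMem_insertion_le (hr : 0 < r) (hI : MeasurableSet I) {x : ℝ}
    (hx : x ∈ Set.Icc 0 T) :
    (expMeasure r).prod m {z | (x, z) ∉ insertion I} ≤
      ENNReal.ofReal (1 - m.real I * Real.exp (-(r * T))) := by
  rw [prod_notMem_insertion hr hI hx.1]
  gcongr
  exact hx.2

lemma ofReal_one_sub_lt_one {a : ℝ} (ha : 0 < a) (y : ℝ) :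
    ENNReal.ofReal (1 - a * Real.exp y) < 1 :=
  ENNReal.ofReal_lt_one.2 (by have := mul_pos ha (Real.exp_pos y); linarith)

/-- The mean time out of the cache in one step is $e^{-rx}/r$ and the insertion probability is
$m(I)e^{-rx}$. Their ratio does not depend on `x`, so a constant solves the one-step equation. -/
lemma lintegral_offReward_step (hr : 0 < r) (hI : MeasurableSet I) (hpos : 0 < m.real I) {x : ℝ}
    (hx : 0 ≤ x) :
    ∫⁻ z, (ENNReal.ofReal (offReward x z) + {z | (x, z) ∉ insertion I}.indicator
      (fun _ => ENNReal.ofReal (1 / (r * m.real I))) z) ∂(expMeasure r).prod m =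
    ENNReal.ofReal (1 / (r * m.real I)) := by
  have := isProbabilityMeasure_expMeasure hr
  have hS : MeasurableSet {z : ℝ × E | (x, z) ∉ insertion I} :=
    measurable_prodMk_left (measurableSet_insertion hI).compl
  have h1 : ∫⁻ z : ℝ × E, ENNReal.ofReal (offReward x z) ∂(expMeasure r).prod m =
      ENNReal.ofReal (Real.exp (-(r * x)) / r) := by
    have e : ∀ z : ℝ × E, ENNReal.ofReal (offReward x z) = ENNReal.ofReal (z.1 - x) := fun z => by
      simp [offReward, ENNReal.ofReal_max]
    rw [lintegral_congr e, lintegral_prod _ (by fun_prop)]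
    simpa using lintegral_expMeasure_sub hr hx
  have h2 : m.real I * Real.exp (-(r * x)) ≤ 1 :=
    mul_le_one₀ measureReal_le_one (Real.exp_nonneg _)
      (Real.exp_le_one_iff.2 (by have := mul_nonneg hr.le hx; linarith))
  rw [lintegral_add_right _ (measurable_const.indicator hS), h1, lintegral_indicator_const hS,
    prod_notMem_insertion hr hI hx, ← ENNReal.ofReal_mul (by positivity),
    ← ENNReal.ofReal_add (by positivity) (mul_nonneg (by positivity) (by linarith))]
  congr 1
  field_simp
  ring

/-- The expected time to eviction starting from timer `x`, when refreshes occur at rate `l`. -/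
def meanOn (T l x : ℝ) : ℝ := Real.exp (l * T) / l * (1 - Real.exp (-(l * x)))

lemma meanOn_le {l : ℝ} (hl : 0 < l) (x : ℝ) : meanOn T l x ≤ Real.exp (l * T) / l := by
  have h1 : 0 ≤ Real.exp (l * T) / l := by positivity
  have h2 := Real.exp_nonneg (-(l * x))
  calc meanOn T l x ≤ Real.exp (l * T) / l * 1 := by unfold meanOn; gcongr; linarith
    _ = _ := mul_one _

lemma meanOn_nonneg {l : ℝ} (hl : 0 < l) {x : ℝ} (hx : 0 ≤ x) : 0 ≤ meanOn T l x :=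
  mul_nonneg (by positivity)
    (sub_nonneg.2 (Real.exp_le_one_iff.2 (by have := mul_nonneg hl.le hx; linarith)))

lemma meanOn_zero (T l : ℝ) : meanOn T l 0 = 0 := by simp [meanOn]

lemma meanOn_self (T l : ℝ) : meanOn T l T = (Real.exp (l * T) - 1) / l := by
  rw [meanOn, mul_sub, mul_one, div_mul_eq_mul_div, ← Real.exp_add, add_neg_cancel, Real.exp_zero]
  ring

lemma continuous_meanOn (T l : ℝ) : Continuous (meanOn T l) := by unfold meanOn; fun_prop

/-- If the gap `g` is shorter than `x`, the reward is `g` and the timer becomes `T` with probability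
`b`, else `x - g`. If it is longer, the reward is `x` and nothing more is earned: the chain is
either killed or at `0`, where `meanOn` vanishes. Hence `I` does not enter the value. -/
lemma lintegral_onReward_step (hr : 0 < r) (hT : 0 < T) (hR : MeasurableSet R)
    (hI : MeasurableSet I) (hpos : 0 < m.real R) {x : ℝ} (hx : 0 ≤ x) :
    ∫⁻ z, (ENNReal.ofReal (onReward x z) + {z | (x, z) ∉ insertion I}.indicator
      (fun z => ENNReal.ofReal (meanOn T (r * m.real R) (step T R I x z))) z)
        ∂(expMeasure r).prod m =
    ENNReal.ofReal (meanOn T (r * m.real R) x) := by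
  have := isProbabilityMeasure_expMeasure hr
  set b := m.real R with hb
  have hb1 : b ≤ 1 := measureReal_le_one
  set l := r * b with hl
  have hl0 : 0 < l := mul_pos hr hpos
  set U := meanOn T l with hU
  have hU0 : ∀ {y}, 0 ≤ y → 0 ≤ U y := fun h => meanOn_nonneg hl0 h
  -- Reward plus expected future reward, given a gap `g < x`.
  set h : ℝ → ℝ := fun g => g + (b * U T + (1 - b) * U (x - g)) with hh
  have hc : Continuous h := by
    have := continuous_meanOn T l
    simp only [hh, hU]; fun_prop
  have hS : MeasurableSet {z : ℝ × E | (x, z) ∉ insertion I} :=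
    measurable_prodMk_left (measurableSet_insertion hI).compl
  have hstep : Measurable fun z => step T R I x z :=
    (measurable_step hR hI).comp measurable_prodMk_left
  have hmeas : Measurable fun z : ℝ × E => ENNReal.ofReal (onReward x z) +
      {z | (x, z) ∉ insertion I}.indicator (fun z => ENNReal.ofReal (U (step T R I x z))) z :=
    (measurable_onReward.comp measurable_prodMk_left).ennreal_ofReal.add
      (((continuous_meanOn T l).measurable.comp hstep).ennreal_ofReal.indicator hS)
  rw [lintegral_prod _ hmeas.aemeasurable]
  have hinner : ∀ᵐ g ∂expMeasure r, ∫⁻ e, (ENNReal.ofReal (onReward x (g, e)) +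
      {z | (x, z) ∉ insertion I}.indicator
        (fun z => ENNReal.ofReal (U (step T R I x z))) (g, e)) ∂m =
      (Set.Iio x).indicator (fun g => ENNReal.ofReal (h g)) g +
        (Set.Ici x).indicator (fun _ => ENNReal.ofReal x) g := by
    filter_upwards [ae_pos_expMeasure r] with g hg
    rcases lt_or_ge g x with hgx | hgx
    · rw [Set.indicator_of_mem (Set.mem_Iio.2 hgx), Set.indicator_of_notMem (by simpa using hgx),
        add_zero]
      have e : ∀ e : E, ENNReal.ofReal (onReward x (g, e)) +
          {z | (x, z) ∉ insertion I}.indicator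
            (fun z => ENNReal.ofReal (U (step T R I x z))) (g, e) =
          ENNReal.ofReal g + (R.indicator (fun _ => ENNReal.ofReal (U T)) e +
            Rᶜ.indicator (fun _ => ENNReal.ofReal (U (x - g))) e) := fun e => by
        have h1 : onReward x (g, e) = g := by
          simp only [onReward, min_eq_left hgx.le, max_eq_left hg.le]
        have h2 : (g, e) ∈ {z : ℝ × E | (x, z) ∉ insertion I} := by
          simp [insertion, hgx]
        rw [h1, Set.indicator_of_mem h2]
        by_cases he : e ∈ R <;> simp [step, hgx, he]
      rw [lintegral_congr e, lintegral_add_left measurable_const,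
        lintegral_add_left (measurable_const.indicator hR), lintegral_indicator_const hR,
        lintegral_indicator_const hR.compl, lintegral_const, measure_univ, mul_one,
        ← ofReal_measureReal (μ := m) (s := R), ← ofReal_measureReal (μ := m) (s := Rᶜ),
        probReal_compl_eq_one_sub hR, ← hb, ← ENNReal.ofReal_mul (hU0 hT.le),
        ← ENNReal.ofReal_mul (hU0 (by linarith)),
        ← ENNReal.ofReal_add (mul_nonneg (hU0 hT.le) hpos.le)
          (mul_nonneg (hU0 (by linarith)) (by linarith)),
        ← ENNReal.ofReal_add hg.le (add_nonneg (mul_nonneg (hU0 hT.le) hpos.le)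
          (mul_nonneg (hU0 (by linarith)) (by linarith)))]
      simp only [hh]
      ring_nf
    · rw [Set.indicator_of_notMem (by simpa using hgx), Set.indicator_of_mem (Set.mem_Ici.2 hgx),
        zero_add]
      have e : ∀ e : E, ENNReal.ofReal (onReward x (g, e)) +
          {z | (x, z) ∉ insertion I}.indicator
            (fun z => ENNReal.ofReal (U (step T R I x z))) (g, e) = ENNReal.ofReal x := fun e => by
        have h1 : onReward x (g, e) = x := by
          simp only [onReward, min_eq_right hgx, max_eq_left hx]
        rw [h1]
        by_cases he : e ∈ I
        · simp [insertion, hgx, he]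
        · simp [insertion, step, hgx, he, not_lt.2 hgx, hU, meanOn_zero]
      rw [lintegral_congr e, lintegral_const, measure_univ, mul_one]
  rw [lintegral_congr_ae hinner, lintegral_add_right _ (measurable_const.indicator measurableSet_Ici),
    lintegral_expMeasure_Ici_const hr hx hx]
  set c := Real.exp (l * T) / l with hcdef
  set k := b * U T + (1 - b) * c with hk
  -- Since $U(x-g)=c(1-e^{-lx}e^{lg})$, `h g` equals $g+k-(1-b)c\,e^{-lx}e^{lg}$. As $r-l=r(1-b)$,
  -- the last term times the density is a multiple of $e^{-r(1-b)g}$.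
  have hΨ : ∀ g, HasDerivAt (fun g => -(g + 1 / r + k) * Real.exp (-(r * g)) +
      c * Real.exp (-(l * x)) * Real.exp (-(r * (1 - b) * g)))
      (r * Real.exp (-(r * g)) * h g) g := fun g => by
    have h1 : HasDerivAt (fun g : ℝ => -(g + 1 / r + k)) (-1) g :=
      (((hasDerivAt_id g).add_const (1 / r)).add_const k).neg
    refine ((h1.mul (hasDerivAt_exp_neg_mul r g)).add
      ((hasDerivAt_exp_neg_mul (r * (1 - b)) g).const_mul _)).congr_deriv ?_
    have h2 : Real.exp (-(r * (1 - b) * g)) = Real.exp (-(r * g)) * Real.exp (l * g) := by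
      rw [← Real.exp_add, hl]; ring_nf
    have h3 : U (x - g) = c * (1 - Real.exp (-(l * x)) * Real.exp (l * g)) := by
      rw [← Real.exp_add, hU, meanOn, ← hcdef]; ring_nf
    simp only [hh, h3, h2, hk]
    field_simp
    ring
  rw [lintegral_expMeasure_Iio hr hx hc _ hΨ]
  · have e1 : Real.exp (-(l * x)) * Real.exp (-(r * (1 - b) * x)) = Real.exp (-(r * x)) := by
      rw [← Real.exp_add, hl]; ring_nf
    -- Here $U(T)=c-1/l$ and $b/l=1/r$.
    have e2 : k = c - 1 / r := by
      rw [hk, hU, meanOn_self, hcdef, hl]; field_simp; ring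
    have e3 : -(x + 1 / r + k) * Real.exp (-(r * x)) +
        c * Real.exp (-(l * x)) * Real.exp (-(r * (1 - b) * x)) -
        (-(0 + 1 / r + k) * Real.exp (-(r * 0)) +
          c * Real.exp (-(l * x)) * Real.exp (-(r * (1 - b) * 0))) =
        U x - x * Real.exp (-(r * x)) := by
      rw [mul_assoc c, e1, e2, hU, meanOn, ← hcdef]; simp; ring
    -- Nonnegativity of the first summand is needed to add the two `ENNReal.ofReal` terms; it comes
    -- from $1+y\le e^y$ at $y=lx$.
    have e4 : x * Real.exp (-(r * x)) ≤ U x := by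
      have h1 : l * x * Real.exp (-(l * x)) ≤ 1 - Real.exp (-(l * x)) := by
        have h2 := Real.add_one_le_exp (l * x)
        have h3 : Real.exp (l * x) * Real.exp (-(l * x)) = 1 := by
          rw [← Real.exp_add]; simp
        nlinarith [Real.exp_pos (-(l * x))]
      have h4 : Real.exp (-(r * x)) ≤ Real.exp (-(l * x)) := by
        rw [Real.exp_le_exp, hl]
        nlinarith [mul_nonneg (mul_nonneg hr.le hx) (by linarith : 0 ≤ 1 - b)]
      have h5 : 1 ≤ Real.exp (l * T) := Real.one_le_exp (by positivity)
      have h6 : 0 ≤ 1 - Real.exp (-(l * x)) := le_trans (by positivity) h1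
      calc x * Real.exp (-(r * x)) ≤ x * Real.exp (-(l * x)) := by gcongr
        _ ≤ 1 / l * (1 - Real.exp (-(l * x))) := by
            rw [one_div_mul_eq_div, le_div_iff₀ hl0]; linarith
        _ ≤ U x := by rw [hU, meanOn]; gcongr
    rw [e3, ← ENNReal.ofReal_add (by linarith) (by positivity)]
    ring_nf
  · intro g hg
    have := hU0 (y := x - g) (by linarith [hg.2])
    have := hU0 hT.le
    have : 0 ≤ 1 - b := by linarith
    have := hg.1
    simp only [hh]; positivity

end Expectation

end

end TTLChain

/-! ### Pathwise structure: alternating on and off periods. -/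

namespace TTLChain

open scoped ENNReal
open IIDSeq

noncomputable section

variable {E : Type*} {T : ℝ} {R I : Set E}

/-- The time of the `k`-th event. -/
def arrival (k : ℕ) (w : ℕ → ℝ × E) : ℝ := ∑ j ∈ Finset.range k, (w j).1

lemma arrival_succ_shift (k : ℕ) (w : ℕ → ℝ × E) :
    arrival (k + 1) w = (w 0).1 + arrival k (shift 1 w) := by
  rw [arrival, Finset.sum_range_succ', add_comm]; rfl

lemma arrival_nonneg {w : ℕ → ℝ × E} (hw : ∀ k, 0 ≤ (w k).1) (k : ℕ) : 0 ≤ arrival k w :=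
  Finset.sum_nonneg fun i _ => hw i

/-- The item with initial timer `x` is in the cache at time `t`. -/
def Cached (T : ℝ) (R I : Set E) (x : ℝ) (w : ℕ → ℝ × E) (t : ℝ) : Prop :=
  ∃ k, arrival k w ≤ t ∧ t < arrival (k + 1) w ∧ 0 < state (step T R I) k x w - (t - arrival k w)

/-- First-event decomposition: every pathwise induction below peels off one event through it. -/
lemma cached_iff {x : ℝ} {w : ℕ → ℝ × E} (hw : ∀ k, 0 ≤ (w k).1) (t : ℝ) :
    Cached T R I x w t ↔ (0 ≤ t ∧ t < (w 0).1 ∧ t < x) ∨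
      ((w 0).1 ≤ t ∧ Cached T R I (step T R I x (w 0)) (shift 1 w) (t - (w 0).1)) := by
  constructor
  · rintro ⟨_ | k, h1, h2, h3⟩
    · simp only [arrival, Finset.range_zero, Finset.sum_empty, zero_add, Finset.sum_range_one,
        state, sub_zero, sub_pos] at h1 h2 h3
      exact .inl ⟨h1, h2, h3⟩
    · have h0 := arrival_nonneg (w := shift 1 w) (fun k => hw (k + 1)) k
      rw [arrival_succ_shift] at h1 h2 h3
      refine .inr ⟨by linarith, k, by linarith, by linarith, ?_⟩
      rw [state] at h3
      linarith
  · rintro (⟨h1, h2, h3⟩ | ⟨h0, k, h1, h2, h3⟩)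
    · refine ⟨0, ?_⟩
      simp only [arrival, Finset.range_zero, Finset.sum_empty, zero_add, Finset.sum_range_one,
        state, sub_zero, sub_pos]
      exact ⟨h1, h2, h3⟩
    · refine ⟨k + 1, ?_, ?_, ?_⟩
      · rw [arrival_succ_shift]; linarith
      · rw [arrival_succ_shift]; linarith
      · rw [arrival_succ_shift, state]; linarith

lemma cached_zero {x : ℝ} (hx : 0 < x) {w : ℕ → ℝ × E} (hw : ∀ k, 0 < (w k).1) :
    Cached T R I x w 0 :=
  (cached_iff (fun k => (hw k).le) 0).2 (.inl ⟨le_rfl, hw 0, hx⟩)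

lemma step_of_lt {x : ℝ} {z : ℝ × E} (h : ¬ z.1 < x) (hz : (x, z) ∉ insertion I) :
    step T R I x z = 0 := by
  have h' : ¬ 0 < x - z.1 := by simpa using h
  have : z.2 ∉ I := fun hI => hz ⟨h', hI⟩
  simp [step, h', this]

lemma step_of_mem_insertion {x : ℝ} {z : ℝ × E} (hz : (x, z) ∈ insertion I) :
    step T R I x z = T := by
  have h1 : ¬ 0 < x - z.1 := hz.1
  have h2 : z.2 ∈ I := hz.2
  simp [step, h1, h2]

/-- A timer at `0` stays at `0` until the insertion, so no further time in the cache accrues. -/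
lemma partialReward_onReward_zero {k : ℕ} {w : ℕ → ℝ × E} (hw : ∀ k, 0 < (w k).1)
    (h : KilledAt (step T R I) (insertion I) k 0 w) :
    partialReward (step T R I) onReward (k + 1) 0 w = 0 := by
  have h0 : onReward 0 (w 0) = 0 := by simp [onReward, (hw 0).le]
  induction k generalizing w with
  | zero => rw [partialReward_succ, h0]; simp [partialReward]
  | succ k ih =>
    have e : step T R I 0 (w 0) = 0 := step_of_lt (not_lt.2 (hw 0).le) h.1
    rw [partialReward_succ, h0, e, zero_add]
    have h2 := h.2
    rw [e] at h2
    exact ih (fun k => hw (k + 1)) h2 (by simp [onReward, (hw 1).le])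

lemma partialReward_on_add_off (hT : 0 ≤ T) {k : ℕ} {x : ℝ} (hx : x ∈ Set.Icc 0 T)
    {w : ℕ → ℝ × E} (hw : ∀ k, 0 ≤ (w k).1) :
    partialReward (step T R I) onReward k x w + partialReward (step T R I) offReward k x w =
      arrival k w := by
  induction k generalizing x w with
  | zero => simp [partialReward, arrival]
  | succ k ih =>
    have h1 := ih (step_mem_Icc hT R I hx (hw 0)) (w := shift 1 w) fun k => hw (k + 1)
    have h2 := onReward_add_offReward hx.1 (hw 0)
    rw [partialReward_succ, partialReward_succ, arrival_succ_shift]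
    linarith

/-- The path from timer `x` is regular: events are separated, no eviction coincides with an event,
and the item is inserted some time. -/
structure Regular (T : ℝ) (R I : Set E) (x : ℝ) (w : ℕ → ℝ × E) : Prop where
  pos : ∀ k, 0 < (w k).1
  ne : ∀ k, (w k).1 ≠ state (step T R I) k x w
  killed : ∃ k, KilledAt (step T R I) (insertion I) k x w

/-- Up to the killing insertion there is a single eviction: after it the timer remains `0`. So the
total on-reward is the eviction time, and from the insertion on the path restarts with timer `T`.
The condition `hne` makes the off period nonempty: if the timer ran out exactly at the inserting
event, the two on periods would merge. -/
lemma cached_of_killedAt (hT : 0 < T) {k : ℕ} {x : ℝ} (hx : x ∈ Set.Icc 0 T) {w : ℕ → ℝ × E}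
    (hw : ∀ k, 0 < (w k).1) (hne : ∀ k, (w k).1 ≠ state (step T R I) k x w)
    (h : KilledAt (step T R I) (insertion I) k x w) :
    0 ≤ partialReward (step T R I) onReward (k + 1) x w ∧
    partialReward (step T R I) onReward (k + 1) x w < arrival (k + 1) w ∧
    (∀ t, 0 ≤ t → t < partialReward (step T R I) onReward (k + 1) x w → Cached T R I x w t) ∧
    (∀ t, partialReward (step T R I) onReward (k + 1) x w ≤ t → t < arrival (k + 1) w →
      ¬ Cached T R I x w t) ∧
    ∀ t, arrival (k + 1) w ≤ t →
      (Cached T R I x w t ↔ Cached T R I T (shift (k + 1) w) (t - arrival (k + 1) w)) := by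
  have hw' : ∀ k, 0 ≤ (w k).1 := fun k => (hw k).le
  induction k generalizing x w with
  | zero =>
    have h0 : (x, w 0) ∈ insertion I := h
    have hxg : x < (w 0).1 := lt_of_le_of_ne (by simpa using h0.1) (hne 0).symm
    have hA : partialReward (step T R I) onReward (0 + 1) x w = x := by
      rw [partialReward_succ]
      simp [partialReward, onReward, hxg.le, hx.1]
    have hD : arrival (0 + 1) w = (w 0).1 := by simp [arrival]
    rw [hA, hD]
    refine ⟨hx.1, hxg, fun t h1 h2 => (cached_iff hw' t).2 (.inl ⟨h1, h2.trans hxg, h2⟩),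
      fun t h1 h2 hc => ?_, fun t h1 => ?_⟩
    · rcases (cached_iff hw' t).1 hc with h3 | h3 <;> linarith [h3.1, h3.2]
    · rw [cached_iff hw', step_of_mem_insertion h0]
      exact ⟨fun h3 => h3.elim (fun h3 => absurd h3.2.1 (not_lt.2 h1)) And.right,
        fun h3 => .inr ⟨h1, h3⟩⟩
  | succ k ih =>
    have hx' := step_mem_Icc hT.le R I hx (hw' 0)
    obtain ⟨i1, i2, i3, i4, i5⟩ := ih hx' (w := shift 1 w) (fun k => hw (k + 1))
      (fun k => hne (k + 1)) h.2 (fun k => hw' (k + 1))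
    rw [partialReward_succ, arrival_succ_shift (k + 1) w, shift_succ (k + 1)]
    set A' := partialReward (step T R I) onReward (k + 1) (step T R I x (w 0)) (shift 1 w)
    set D' := arrival (k + 1) (shift 1 w)
    have hlate : ∀ t, (w 0).1 + D' ≤ t → (Cached T R I x w t ↔
        Cached T R I T (shift (k + 1) (shift 1 w)) (t - ((w 0).1 + D'))) := fun t ht => by
      have hgt : (w 0).1 ≤ t := by linarith
      rw [cached_iff hw', ← sub_sub, ← i5 (t - (w 0).1) (by linarith)]
      exact ⟨fun h3 => h3.elim (fun h3 => absurd h3.2.1 (not_lt.2 hgt)) And.right,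
        fun h3 => .inr ⟨hgt, h3⟩⟩
    by_cases hg : (w 0).1 < x
    · have hon : onReward x (w 0) = (w 0).1 := by simp [onReward, hg.le, hw' 0]
      rw [hon]
      refine ⟨by linarith [hw' 0], by linarith, fun t h1 h2 => ?_, fun t h1 h2 hc => ?_, hlate⟩
      · refine (cached_iff hw' t).2 ?_
        rcases lt_or_ge t (w 0).1 with h3 | h3
        · exact .inl ⟨h1, h3, h3.trans hg⟩
        · exact .inr ⟨h3, i3 _ (by linarith) (by linarith)⟩
      · rcases (cached_iff hw' t).1 hc with h3 | h3
        · linarith [h3.2.1]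
        · exact i4 _ (by linarith) (by linarith) h3.2
    -- The timer runs out before the next event and that event does not insert: all remaining time
    -- up to the insertion is off time.
    · have e : step T R I x (w 0) = 0 := step_of_lt hg h.1
      have hA' : A' = 0 := by
        have h2 := h.2
        rw [e] at h2
        simp only [A', e]
        exact partialReward_onReward_zero (fun k => hw (k + 1)) h2
      have hg := not_lt.1 hg
      have hon : onReward x (w 0) = x := by simp [onReward, hg, hx.1]
      have hgx : x < (w 0).1 := lt_of_le_of_ne hg (hne 0).symm
      rw [hon, hA', add_zero]
      refine ⟨hx.1, by linarith, fun t h1 h2 => ?_, fun t h1 h2 hc => ?_, hlate⟩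
      · exact (cached_iff hw' t).2 (.inl ⟨h1, h2.trans hgx, h2⟩)
      · rcases (cached_iff hw' t).1 hc with h3 | h3
        · linarith [h3.2.2]
        · exact i4 _ (by linarith) (by linarith) h3.2

/-- The time until eviction, starting from timer `x`. -/
def onTime (T : ℝ) (R I : Set E) (x : ℝ) (w : ℕ → ℝ × E) : ℝ :=
  totalReward (step T R I) (insertion I) onReward x w

/-- The time from eviction to insertion, starting from timer `x`. -/
def offTime (T : ℝ) (R I : Set E) (x : ℝ) (w : ℕ → ℝ × E) : ℝ :=
  totalReward (step T R I) (insertion I) offReward x w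

/-- The driving sequence after the next insertion, starting from timer `x`. -/
def afterInsertion (T : ℝ) (R I : Set E) (x : ℝ) (w : ℕ → ℝ × E) : ℕ → ℝ × E :=
  afterKill (step T R I) (insertion I) x w

lemma onTime_nonneg (x : ℝ) (w : ℕ → ℝ × E) : 0 ≤ onTime T R I x w := by
  unfold onTime totalReward partialReward
  exact Finset.sum_nonneg fun _ _ => onReward_nonneg _ _

lemma offTime_nonneg (x : ℝ) (w : ℕ → ℝ × E) : 0 ≤ offTime T R I x w := by
  unfold offTime totalReward partialReward
  exact Finset.sum_nonneg fun _ _ => offReward_nonneg _ _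

/-- The first cycle of a regular path. -/
lemma Regular.cycle (hT : 0 < T) {x : ℝ} (hx : x ∈ Set.Icc 0 T) {w : ℕ → ℝ × E}
    (h : Regular T R I x w) :
    0 < offTime T R I x w ∧
    (∀ t, 0 ≤ t → t < onTime T R I x w → Cached T R I x w t) ∧
    (∀ t, onTime T R I x w ≤ t → t < onTime T R I x w + offTime T R I x w →
      ¬ Cached T R I x w t) ∧
    ∀ t, onTime T R I x w + offTime T R I x w ≤ t →
      (Cached T R I x w t ↔ Cached T R I T (afterInsertion T R I x w)
        (t - (onTime T R I x w + offTime T R I x w))) := by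
  obtain ⟨k, hk⟩ := h.killed
  obtain ⟨-, h2, h3, h4, h5⟩ := cached_of_killedAt hT hx h.pos h.ne hk
  have h6 := partialReward_on_add_off (R := R) (I := I) hT.le (k := k + 1) hx
    fun k => (h.pos k).le
  simp only [onTime, offTime, afterInsertion, totalReward, afterKill, hk.killIndex_eq]
  rw [h6]
  exact ⟨by linarith, h3, h4, h5⟩

/-- The driving sequence after the insertion with index `i`. -/
def tailSeq (T : ℝ) (R I : Set E) (x : ℝ) (w : ℕ → ℝ × E) (i : ℕ) : ℕ → ℝ × E :=
  (afterInsertion T R I T)^[i] (afterInsertion T R I x w)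

lemma tailSeq_succ (x : ℝ) (w : ℕ → ℝ × E) (i : ℕ) :
    tailSeq T R I x w (i + 1) = afterInsertion T R I T (tailSeq T R I x w i) :=
  Function.iterate_succ_apply' _ _ _

/-- The time of the insertion with index `i`. -/
def insTime (T : ℝ) (R I : Set E) (x : ℝ) (w : ℕ → ℝ × E) (i : ℕ) : ℝ :=
  (onTime T R I x w + offTime T R I x w) + ∑ j ∈ Finset.range i,
    (onTime T R I T (tailSeq T R I x w j) + offTime T R I T (tailSeq T R I x w j))

lemma insTime_succ (x : ℝ) (w : ℕ → ℝ × E) (i : ℕ) :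
    insTime T R I x w (i + 1) = insTime T R I x w i +
      onTime T R I T (tailSeq T R I x w i) + offTime T R I T (tailSeq T R I x w i) := by
  rw [insTime, Finset.sum_range_succ, insTime]; ring

lemma insTime_monotone (x : ℝ) (w : ℕ → ℝ × E) : Monotone (insTime T R I x w) :=
  monotone_nat_of_le_succ fun i => by
    rw [insTime_succ]
    linarith [onTime_nonneg (T := T) (R := R) (I := I) T (tailSeq T R I x w i),
      offTime_nonneg (T := T) (R := R) (I := I) T (tailSeq T R I x w i)]

lemma insTime_nonneg (x : ℝ) (w : ℕ → ℝ × E) (i : ℕ) : 0 ≤ insTime T R I x w i :=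
  le_trans (by simpa [insTime] using add_nonneg (onTime_nonneg x w) (offTime_nonneg x w))
    (insTime_monotone x w (Nat.zero_le i))

/-- All cycles of the path are regular. -/
structure FullyRegular (T : ℝ) (R I : Set E) (x : ℝ) (w : ℕ → ℝ × E) : Prop where
  start : Regular T R I x w
  tail : ∀ i, Regular T R I T (tailSeq T R I x w i)

/-- Each insertion sets the timer to `T`, so the first-cycle description applies again from there.
-/
lemma FullyRegular.cached_tail (hT : 0 < T) {x : ℝ} (hx : x ∈ Set.Icc 0 T)
    {w : ℕ → ℝ × E} (h : FullyRegular T R I x w) (i : ℕ) {t : ℝ} (ht : insTime T R I x w i ≤ t) :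
    Cached T R I x w t ↔ Cached T R I T (tailSeq T R I x w i) (t - insTime T R I x w i) := by
  induction i with
  | zero =>
    have e : insTime T R I x w 0 = onTime T R I x w + offTime T R I x w := by simp [insTime]
    rw [e] at ht ⊢
    exact (h.start.cycle hT hx).2.2.2 t ht
  | succ i ih =>
    rw [ih ((insTime_monotone x w i.le_succ).trans ht)]
    rw [insTime_succ] at ht ⊢
    rw [((h.tail i).cycle hT ⟨hT.le, le_rfl⟩).2.2.2 _ (by linarith), tailSeq_succ]
    ring_nf

lemma FullyRegular.cached_of_lt (hT : 0 < T) {x : ℝ} (hx : x ∈ Set.Icc 0 T)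
    {w : ℕ → ℝ × E} (h : FullyRegular T R I x w) (i : ℕ) {t : ℝ} (h1 : insTime T R I x w i ≤ t)
    (h2 : t < insTime T R I x w i + onTime T R I T (tailSeq T R I x w i)) :
    Cached T R I x w t :=
  (h.cached_tail hT hx i h1).2
    (((h.tail i).cycle hT ⟨hT.le, le_rfl⟩).2.1 _ (by linarith) (by linarith))

lemma FullyRegular.not_cached_of_lt (hT : 0 < T) {x : ℝ} (hx : x ∈ Set.Icc 0 T)
    {w : ℕ → ℝ × E} (h : FullyRegular T R I x w) (i : ℕ) {t : ℝ}
    (h1 : insTime T R I x w i + onTime T R I T (tailSeq T R I x w i) ≤ t)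
    (h2 : t < insTime T R I x w (i + 1)) : ¬ Cached T R I x w t := by
  rw [insTime_succ] at h2
  have h0 := onTime_nonneg (T := T) (R := R) (I := I) T (tailSeq T R I x w i)
  rw [h.cached_tail hT hx i (by linarith)]
  exact ((h.tail i).cycle hT ⟨hT.le, le_rfl⟩).2.2.1 _ (by linarith) (by linarith)

lemma FullyRegular.cached_insTime (hT : 0 < T) {x : ℝ} (hx : x ∈ Set.Icc 0 T)
    {w : ℕ → ℝ × E} (h : FullyRegular T R I x w) (i : ℕ) :
    Cached T R I x w (insTime T R I x w i) := by
  rw [h.cached_tail hT hx i le_rfl, sub_self]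
  exact cached_zero hT (h.tail i).pos

/-- On and off periods are closed on the left and open on the right, so the infima defining the
cycle times are attained. -/
lemma sInf_eq_of_switch {p : ℝ → Prop} {a b : ℝ} (hab : a ≤ b) (h1 : ∀ t, a ≤ t → t < b → ¬ p t)
    (h2 : p b) : sInf {t | a ≤ t ∧ p t} = b :=
  IsLeast.csInf_eq ⟨⟨hab, h2⟩, fun _ ht => not_lt.1 fun hlt => h1 _ ht.1 hlt ht.2⟩

lemma FullyRegular.sInf_start_out (hT : 0 < T) {x : ℝ} (hx : x ∈ Set.Icc 0 T)
    {w : ℕ → ℝ × E} (h : FullyRegular T R I x w) :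
    sInf {t | 0 ≤ t ∧ ¬ Cached T R I x w t} = onTime T R I x w :=
  have hc := h.start.cycle hT hx
  sInf_eq_of_switch (onTime_nonneg _ _) (fun t h1 h2 => not_not.2 (hc.2.1 t h1 h2))
    (hc.2.2.1 _ le_rfl (by linarith [hc.1]))

lemma FullyRegular.sInf_start_in (hT : 0 < T) {x : ℝ} (hx : x ∈ Set.Icc 0 T)
    {w : ℕ → ℝ × E} (h : FullyRegular T R I x w) :
    sInf {t | onTime T R I x w ≤ t ∧ Cached T R I x w t} = insTime T R I x w 0 := by
  have hc := h.start.cycle hT hx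
  have e : insTime T R I x w 0 = onTime T R I x w + offTime T R I x w := by simp [insTime]
  refine sInf_eq_of_switch (by linarith [hc.1]) (fun t h1 h2 => hc.2.2.1 t h1 (by linarith))
    (h.cached_insTime hT hx 0)

lemma FullyRegular.sInf_out (hT : 0 < T) {x : ℝ} (hx : x ∈ Set.Icc 0 T)
    {w : ℕ → ℝ × E} (h : FullyRegular T R I x w) (i : ℕ) :
    sInf {t | insTime T R I x w i ≤ t ∧ ¬ Cached T R I x w t} =
      insTime T R I x w i + onTime T R I T (tailSeq T R I x w i) := by
  have hc := (h.tail i).cycle hT ⟨hT.le, le_rfl⟩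
  have h0 := onTime_nonneg (T := T) (R := R) (I := I) T (tailSeq T R I x w i)
  refine sInf_eq_of_switch (by linarith) (fun t h1 h2 => not_not.2 (h.cached_of_lt hT hx i h1 h2))
    (h.not_cached_of_lt hT hx i le_rfl ?_)
  rw [insTime_succ]; linarith [hc.1]

lemma FullyRegular.sInf_in (hT : 0 < T) {x : ℝ} (hx : x ∈ Set.Icc 0 T)
    {w : ℕ → ℝ × E} (h : FullyRegular T R I x w) (i : ℕ) :
    sInf {t | insTime T R I x w i + onTime T R I T (tailSeq T R I x w i) ≤ t ∧
      Cached T R I x w t} = insTime T R I x w (i + 1) := by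
  have hc := (h.tail i).cycle hT ⟨hT.le, le_rfl⟩
  refine sInf_eq_of_switch (by rw [insTime_succ]; linarith [hc.1])
    (fun t h1 h2 => h.not_cached_of_lt hT hx i h1 h2) (h.cached_insTime hT hx (i + 1))

lemma FullyRegular.volume_cached (hT : 0 < T) {x : ℝ} (hx : x ∈ Set.Icc 0 T)
    {w : ℕ → ℝ × E} (h : FullyRegular T R I x w) (i : ℕ) :
    volume {u | u ∈ Set.Ico 0 (insTime T R I x w i) ∧ Cached T R I x w u} =
      ENNReal.ofReal (onTime T R I x w +
        ∑ j ∈ Finset.range i, onTime T R I T (tailSeq T R I x w j)) := by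
  induction i with
  | zero =>
    have hc := h.start.cycle hT hx
    have e : insTime T R I x w 0 = onTime T R I x w + offTime T R I x w := by simp [insTime]
    have : {u | u ∈ Set.Ico 0 (insTime T R I x w 0) ∧ Cached T R I x w u} =
        Set.Ico 0 (onTime T R I x w) := by
      ext u
      rw [e]
      constructor
      · exact fun hu => ⟨hu.1.1, not_le.1 fun hle => hc.2.2.1 u hle hu.1.2 hu.2⟩
      · exact fun hu => ⟨⟨hu.1, by linarith [hu.2, hc.1]⟩, hc.2.1 u hu.1 hu.2⟩
    rw [this, Real.volume_Ico]; simp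
  | succ i ih =>
    have hc := (h.tail i).cycle hT ⟨hT.le, le_rfl⟩
    have hon := onTime_nonneg (T := T) (R := R) (I := I) T (tailSeq T R I x w i)
    have h0 := insTime_nonneg (T := T) (R := R) (I := I) x w i
    have e := insTime_succ (T := T) (R := R) (I := I) x w i
    have : {u | u ∈ Set.Ico 0 (insTime T R I x w (i + 1)) ∧ Cached T R I x w u} =
        {u | u ∈ Set.Ico 0 (insTime T R I x w i) ∧ Cached T R I x w u} ∪
          Set.Ico (insTime T R I x w i)
            (insTime T R I x w i + onTime T R I T (tailSeq T R I x w i)) := by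
      ext u
      constructor
      · intro hu
        rcases lt_or_ge u (insTime T R I x w i) with hlt | hge
        · exact .inl ⟨⟨hu.1.1, hlt⟩, hu.2⟩
        · exact .inr ⟨hge, not_le.1 fun hle => h.not_cached_of_lt hT hx i hle hu.1.2 hu.2⟩
      · rintro (hu | hu)
        · exact ⟨⟨hu.1.1, hu.1.2.trans_le (insTime_monotone x w i.le_succ)⟩, hu.2⟩
        · exact ⟨⟨h0.trans hu.1, by linarith [hu.2, hc.1]⟩, h.cached_of_lt hT hx i hu.1 hu.2⟩
    rw [this, measure_union _ measurableSet_Ico, ih, Real.volume_Ico, Finset.sum_range_succ,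
      ← ENNReal.ofReal_add (add_nonneg (onTime_nonneg _ _)
        (Finset.sum_nonneg fun j _ => onTime_nonneg _ _)) (by linarith)]
    · ring_nf
    · exact Set.disjoint_left.2 fun u hu hu' => absurd hu.1.2 (not_lt.2 hu'.1)

end

end TTLChain

/-! ### From cycle averages to time averages. -/

/-- If a nondecreasing function grows by `a` and time by `c` per cycle in the long run, then the
function grows at rate `a / c`. -/
lemma tendsto_div_of_tendsto_cycles {O : ℝ → ℝ} {M : ℕ → ℝ} {a c : ℝ}
    (hO : ∀ s t, 0 ≤ s → s ≤ t → O s ≤ O t) (hO0 : 0 ≤ O 0) (hM : Monotone M)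
    (hc : 0 < c) (hMc : Tendsto (fun i : ℕ => M i / i) atTop (𝓝 c))
    (hOa : Tendsto (fun i : ℕ => O (M i) / i) atTop (𝓝 a)) :
    Tendsto (fun t => O t / t) atTop (𝓝 (a / c)) := by
  classical
  have hMtop : Tendsto M atTop atTop := by
    have := hMc.pos_mul_atTop hc tendsto_natCast_atTop_atTop
    refine this.congr' ?_
    filter_upwards [eventually_gt_atTop 0] with i hi
    field_simp
  have hex : ∀ t, ∃ i, t < M i := fun t => (hMtop.eventually_gt_atTop t).exists
  -- `N t` is the first index whose time exceeds `t`, so eventually `M (N t - 1) ≤ t < M (N t)`.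
  set N : ℝ → ℕ := fun t => Nat.find (hex t) with hN
  have hN1 : ∀ t, t < M (N t) := fun t => Nat.find_spec (hex t)
  have hNtop : Tendsto N atTop atTop := by
    refine tendsto_atTop.2 fun k => ?_
    filter_upwards [eventually_ge_atTop (M k)] with t ht
    by_contra hlt
    exact absurd ((hN1 t).trans_le (hM (not_le.1 hlt).le)) (not_lt.2 ht)
  have hpred : Tendsto (fun t => N t - 1) atTop atTop := (tendsto_sub_atTop_nat 1).comp hNtop
  have hratio : Tendsto (fun i : ℕ => ((i + 1 : ℕ) : ℝ) / i) atTop (𝓝 1) := by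
    have : Tendsto (fun i : ℕ => 1 + 1 / (i : ℝ)) atTop (𝓝 (1 + 0)) :=
      tendsto_const_nhds.add tendsto_one_div_atTop_nhds_zero_nat
    rw [add_zero] at this
    refine this.congr' ?_
    filter_upwards [eventually_gt_atTop 0] with i hi
    push_cast
    field_simp
  -- By monotonicity `O t / t` lies between `O (M i) / M (i + 1)` and `O (M (i + 1)) / M i` with `i
  -- = N t - 1`; both have limit `a / c`.
  have hlow : Tendsto (fun i : ℕ => O (M i) / M (i + 1)) atTop (𝓝 (a / c)) := by
    have h1 := (hOa.div ((tendsto_add_atTop_iff_nat 1).2 hMc) hc.ne').div hratio one_ne_zero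
    rw [div_one] at h1
    refine h1.congr' ?_
    filter_upwards [eventually_gt_atTop 0, hMtop.eventually_gt_atTop 0,
      ((tendsto_add_atTop_iff_nat 1).2 hMtop).eventually_gt_atTop 0] with i hi h2 h3
    simp only [Pi.div_apply]
    push_cast
    field_simp
  have hhigh : Tendsto (fun i : ℕ => O (M (i + 1)) / M i) atTop (𝓝 (a / c)) := by
    have h1 := (((tendsto_add_atTop_iff_nat 1).2 hOa).div hMc hc.ne').mul hratio
    rw [mul_one] at h1
    refine h1.congr' ?_
    filter_upwards [eventually_gt_atTop 0, hMtop.eventually_gt_atTop 0] with i hi h2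
    simp only [Pi.div_apply]
    push_cast
    field_simp
  -- Eventually `N t ≥ 1`, so the natural subtraction is genuine.
  have hev : ∀ᶠ t in atTop, 0 < M (N t - 1) ∧ M (N t - 1) ≤ t ∧ N t - 1 + 1 = N t := by
    filter_upwards [hpred.eventually (hMtop.eventually_gt_atTop 0), hNtop.eventually_ge_atTop 1]
      with t h1 h2
    have h3 : N t - 1 < N t := by omega
    exact ⟨h1, not_lt.1 (Nat.find_min (hex t) h3), by omega⟩
  refine tendsto_of_tendsto_of_tendsto_of_le_of_le' (hlow.comp hpred) (hhigh.comp hpred) ?_ ?_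
  · filter_upwards [hev] with t ⟨h1, h2, h3⟩
    simp only [Function.comp, h3]
    have h4 := hO _ _ h1.le h2
    have h5 : 0 ≤ O (M (N t - 1)) := hO0.trans (hO _ _ le_rfl h1.le)
    have h6 : 0 < t := h1.trans_le h2
    have h7 := (hN1 t).le
    have h8 := h5.trans h4
    gcongr
  · filter_upwards [hev] with t ⟨h1, h2, h3⟩
    simp only [Function.comp, h3]
    have h6 : 0 < t := h1.trans_le h2
    have h4 := hO _ _ h6.le (hN1 t).le
    have h5 : 0 ≤ O (M (N t)) := hO0.trans (hO _ _ le_rfl (h6.le.trans (hN1 t).le))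
    gcongr

/-! ### Almost sure regularity, mean cycle lengths and the limiting fraction of time. -/

namespace TTLChain

open scoped ENNReal
open IIDSeq

noncomputable section

variable {E : Type*} [MeasurableSpace E] {T r : ℝ} {m : Measure E} [IsProbabilityMeasure m]
  {R I : Set E}

/-- The joint law of an inter-event time and a mark. -/
abbrev eventLaw (r : ℝ) (m : Measure E) : Measure (ℝ × E) := (expMeasure r).prod m

lemma ae_forall_pos [IsProbabilityMeasure (eventLaw r m)] :
    ∀ᵐ w ∂iid (eventLaw r m), ∀ k, 0 < (w k).1 :=
  ae_all_iff.2 fun k => (measurePreserving_eval_infinitePi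
    (fun _ : ℕ => eventLaw r m) k).quasiMeasurePreserving.ae (ae_pos_fst r m)

/-- The state before a gap depends only on earlier terms, and the gap has no atoms. Conditioning on
the first term repeatedly reduces to a comparison with a constant. -/
lemma ae_ne_state [IsProbabilityMeasure (eventLaw r m)] (hR : MeasurableSet R)
    (hI : MeasurableSet I) (k : ℕ) (x : ℝ) :
    ∀ᵐ w ∂iid (eventLaw r m), (w k).1 ≠ state (step T R I) k x w := by
  have hm : ∀ k x, MeasurableSet
      {w : ℕ → ℝ × E | (w k).1 = state (step T R I) k x w} := fun k x =>
    measurableSet_eq_fun (measurable_fst.comp (measurable_pi_apply k))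
      ((measurable_state (measurable_step hR hI) k).comp measurable_prodMk_left)
  have hz : iid (eventLaw r m) {w | (w k).1 = state (step T R I) k x w} = 0 := by
    induction k generalizing x with
    | zero =>
      have h0 : eventLaw r m {z | z.1 = x} = 0 := by
        have : {z : ℝ × E | z.1 = x} = {x} ×ˢ Set.univ := by ext; simp
        rw [this, Measure.prod_prod, measure_singleton, zero_mul]
      have hx : MeasurableSet {z : ℝ × E | z.1 = x} := measurableSet_eq_fun (by fun_prop) (by fun_prop)
      exact ((measurePreserving_eval_infinitePi (fun _ : ℕ => eventLaw r m) 0).measure_preimage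
        hx.nullMeasurableSet).trans h0
    | succ k ih =>
      rw [iid_apply (hm (k + 1) x)]
      exact (lintegral_congr fun z => ih (step T R I x z)).trans lintegral_zero
  exact measure_eq_zero_iff_ae_notMem.1 hz

lemma ae_killedAt_insertion [IsProbabilityMeasure (eventLaw r m)] (hr : 0 < r) (hT : 0 < T)
    (hR : MeasurableSet R) (hI : MeasurableSet I) (hpos : 0 < m.real I) {x : ℝ}
    (hx : x ∈ Set.Icc 0 T) :
    ∀ᵐ w ∂iid (eventLaw r m), ∃ k, KilledAt (step T R I) (insertion I) k x w :=
  ae_exists_killedAt (measurable_step hR hI) (measurableSet_insertion hI)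
    (fun _ hx => ae_step_mem_Icc hT.le hx) (ofReal_one_sub_lt_one hpos (-(r * T)))
    (fun _ hx => prod_notMem_insertion_le hr hI hx) hx

lemma ae_regular [IsProbabilityMeasure (eventLaw r m)] (hr : 0 < r) (hT : 0 < T)
    (hR : MeasurableSet R) (hI : MeasurableSet I) (hpos : 0 < m.real I) {x : ℝ}
    (hx : x ∈ Set.Icc 0 T) :
    ∀ᵐ w ∂iid (eventLaw r m), Regular T R I x w := by
  filter_upwards [ae_forall_pos, ae_all_iff.2 fun k => ae_ne_state hR hI k x,
    ae_killedAt_insertion hr hT hR hI hpos hx] with w h1 h2 h3 using ⟨h1, h2, h3⟩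

lemma measurePreserving_afterInsertion [IsProbabilityMeasure (eventLaw r m)] (hr : 0 < r)
    (hT : 0 < T) (hR : MeasurableSet R) (hI : MeasurableSet I) (hpos : 0 < m.real I) {x : ℝ}
    (hx : x ∈ Set.Icc 0 T) :
    MeasurePreserving (afterInsertion T R I x) (iid (eventLaw r m)) (iid (eventLaw r m)) :=
  measurePreserving_afterKill (measurable_step hR hI) (measurableSet_insertion hI)
    (ae_killedAt_insertion hr hT hR hI hpos hx)

lemma measurePreserving_tailSeq [IsProbabilityMeasure (eventLaw r m)] (hr : 0 < r)
    (hT : 0 < T) (hR : MeasurableSet R) (hI : MeasurableSet I) (hpos : 0 < m.real I) {x : ℝ}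
    (hx : x ∈ Set.Icc 0 T) (i : ℕ) :
    MeasurePreserving (fun w => tailSeq T R I x w i) (iid (eventLaw r m)) (iid (eventLaw r m)) :=
  ((measurePreserving_afterInsertion hr hT hR hI hpos ⟨hT.le, le_rfl⟩).iterate i).comp
    (measurePreserving_afterInsertion hr hT hR hI hpos hx)

lemma ae_fullyRegular [IsProbabilityMeasure (eventLaw r m)] (hr : 0 < r) (hT : 0 < T)
    (hR : MeasurableSet R) (hI : MeasurableSet I) (hpos : 0 < m.real I) {x : ℝ}
    (hx : x ∈ Set.Icc 0 T) :
    ∀ᵐ w ∂iid (eventLaw r m), FullyRegular T R I x w := by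
  filter_upwards [ae_regular hr hT hR hI hpos hx, ae_all_iff.2 fun i =>
    (measurePreserving_tailSeq hr hT hR hI hpos hx i).quasiMeasurePreserving.ae
      (ae_regular hr hT hR hI hpos ⟨hT.le, le_rfl⟩)] with w h1 h2 using ⟨h1, h2⟩

lemma measurable_onTime (hR : MeasurableSet R) (hI : MeasurableSet I) (x : ℝ) :
    Measurable (onTime T R I x) :=
  measurable_totalReward (measurable_step hR hI) (measurableSet_insertion hI)
    measurable_onReward x

lemma measurable_offTime (hR : MeasurableSet R) (hI : MeasurableSet I) (x : ℝ) :
    Measurable (offTime T R I x) :=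
  measurable_totalReward (measurable_step hR hI) (measurableSet_insertion hI)
    measurable_offReward x

lemma lintegral_onTime [IsProbabilityMeasure (eventLaw r m)] (hr : 0 < r) (hT : 0 < T)
    (hR : MeasurableSet R) (hI : MeasurableSet I) (hRpos : 0 < m.real R) (hpos : 0 < m.real I)
    {x : ℝ} (hx : x ∈ Set.Icc 0 T) :
    ∫⁻ w, ENNReal.ofReal (onTime T R I x w) ∂iid (eventLaw r m) =
      ENNReal.ofReal (meanOn T (r * m.real R) x) :=
  lintegral_totalReward (φ := fun x => ENNReal.ofReal (meanOn T (r * m.real R) x))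
    (measurable_step hR hI) (measurableSet_insertion hI)
    measurable_onReward onReward_nonneg (fun _ hx => ae_step_mem_Icc hT.le hx)
    (ofReal_one_sub_lt_one hpos (-(r * T))) (fun _ hx => prod_notMem_insertion_le hr hI hx)
    ENNReal.ofReal_ne_top (fun x => ENNReal.ofReal_le_ofReal (meanOn_le (mul_pos hr hRpos) x))
    (continuous_meanOn _ _).measurable.ennreal_ofReal
    (fun _ hx => lintegral_onReward_step hr hT hR hI hRpos hx.1) hx

lemma lintegral_offTime [IsProbabilityMeasure (eventLaw r m)] (hr : 0 < r) (hT : 0 < T)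
    (hR : MeasurableSet R) (hI : MeasurableSet I) (hpos : 0 < m.real I)
    {x : ℝ} (hx : x ∈ Set.Icc 0 T) :
    ∫⁻ w, ENNReal.ofReal (offTime T R I x w) ∂iid (eventLaw r m) =
      ENNReal.ofReal (1 / (r * m.real I)) :=
  lintegral_totalReward (φ := fun _ => ENNReal.ofReal (1 / (r * m.real I)))
    (measurable_step hR hI) (measurableSet_insertion hI)
    measurable_offReward offReward_nonneg (fun _ hx => ae_step_mem_Icc hT.le hx)
    (ofReal_one_sub_lt_one hpos (-(r * T))) (fun _ hx => prod_notMem_insertion_le hr hI hx)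
    ENNReal.ofReal_ne_top (fun _ => le_rfl) measurable_const
    (fun _ hx => lintegral_offReward_step hr hI hpos hx.1) hx

lemma integrable_and_integral_of_lintegral {α : Type*} [MeasurableSpace α] {P : Measure α}
    {f : α → ℝ} (hf : Measurable f) (h0 : ∀ a, 0 ≤ f a) {c : ℝ} (hc : 0 ≤ c)
    (h : ∫⁻ a, ENNReal.ofReal (f a) ∂P = ENNReal.ofReal c) :
    Integrable f P ∧ ∫ a, f a ∂P = c := by
  refine ⟨⟨hf.aestronglyMeasurable, ?_⟩, ?_⟩
  · rw [hasFiniteIntegral_iff_ofReal (.of_forall h0), h]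
    exact ENNReal.ofReal_lt_top
  · rw [integral_eq_lintegral_of_nonneg_ae (.of_forall h0) hf.aestronglyMeasurable, h,
      ENNReal.toReal_ofReal hc]

lemma onTime_integrable_and_integral [IsProbabilityMeasure (eventLaw r m)] (hr : 0 < r)
    (hT : 0 < T) (hR : MeasurableSet R) (hI : MeasurableSet I) (hRpos : 0 < m.real R)
    (hpos : 0 < m.real I) {x : ℝ} (hx : x ∈ Set.Icc 0 T) :
    Integrable (onTime T R I x) (iid (eventLaw r m)) ∧
      ∫ w, onTime T R I x w ∂iid (eventLaw r m) = meanOn T (r * m.real R) x :=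
  integrable_and_integral_of_lintegral (measurable_onTime hR hI x) (onTime_nonneg x)
    (meanOn_nonneg (mul_pos hr hRpos) hx.1) (lintegral_onTime hr hT hR hI hRpos hpos hx)

lemma offTime_integrable_and_integral [IsProbabilityMeasure (eventLaw r m)] (hr : 0 < r)
    (hT : 0 < T) (hR : MeasurableSet R) (hI : MeasurableSet I)
    (hpos : 0 < m.real I) {x : ℝ} (hx : x ∈ Set.Icc 0 T) :
    Integrable (offTime T R I x) (iid (eventLaw r m)) ∧
      ∫ w, offTime T R I x w ∂iid (eventLaw r m) = 1 / (r * m.real I) :=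
  integrable_and_integral_of_lintegral (measurable_offTime hR hI x) (offTime_nonneg x)
    (by positivity) (lintegral_offTime hr hT hR hI hpos hx)

/-- Long-run averages over the cycles. -/
lemma ae_tendsto_cycle_average [IsProbabilityMeasure (eventLaw r m)] (hr : 0 < r) (hT : 0 < T)
    (hR : MeasurableSet R) (hI : MeasurableSet I) (hpos : 0 < m.real I) {x : ℝ}
    (hx : x ∈ Set.Icc 0 T) {q : ℝ → ℝ × E → ℝ} (hq : Measurable (Function.uncurry q))
    (hint : Integrable (totalReward (step T R I) (insertion I) q T) (iid (eventLaw r m))) :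
    ∀ᵐ w ∂iid (eventLaw r m), Tendsto (fun n : ℕ => (∑ i ∈ Finset.range n,
      totalReward (step T R I) (insertion I) q T (tailSeq T R I x w i)) / n) atTop
      (𝓝 (∫ w, totalReward (step T R I) (insertion I) q T w ∂iid (eventLaw r m))) := by
  have hTT : T ∈ Set.Icc 0 T := ⟨hT.le, le_rfl⟩
  -- The initial timer affects only the first insertion. The sequence after it again has the i.i.d.
  -- law, so the strong law is applied there, along the return map from timer `T`.
  exact (measurePreserving_afterInsertion hr hT hR hI hpos hx).quasiMeasurePreserving.ae
    (tendsto_birkhoff_of_indepFun (measurePreserving_afterInsertion hr hT hR hI hpos hTT)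
      (measurable_totalReward (measurable_step hR hI) (measurableSet_insertion hI) hq T) hint
      (indepFun_totalReward_afterKill (measurable_step hR hI) (measurableSet_insertion hI) hq
        (ae_killedAt_insertion hr hT hR hI hpos hTT)))

/-- The fraction of time in the cache converges almost surely. -/
theorem ae_tendsto_occupancy [IsProbabilityMeasure (eventLaw r m)] (hr : 0 < r) (hT : 0 < T)
    (hR : MeasurableSet R) (hI : MeasurableSet I) (hRpos : 0 < m.real R) (hpos : 0 < m.real I)
    {x : ℝ} (hx : x ∈ Set.Icc 0 T) :
    ∀ᵐ w ∂iid (eventLaw r m), Tendsto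
      (fun t : ℝ => volume.real {u | u ∈ Set.Icc 0 t ∧ Cached T R I x w u} / t) atTop
      (𝓝 (meanOn T (r * m.real R) T / (1 / (r * m.real I) + meanOn T (r * m.real R) T))) := by
  have hTT : T ∈ Set.Icc 0 T := ⟨hT.le, le_rfl⟩
  have hon := onTime_integrable_and_integral hr hT hR hI hRpos hpos hTT
  have hoff := offTime_integrable_and_integral hr hT hR hI hpos hTT
  have h1 := ae_tendsto_cycle_average hr hT hR hI hpos hx measurable_onReward hon.1
  have h2 := ae_tendsto_cycle_average hr hT hR hI hpos hx measurable_offReward hoff.1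
  filter_upwards [h1, h2, ae_fullyRegular hr hT hR hI hpos hx] with w h1 h2 hreg
  change Tendsto (fun n : ℕ => (∑ i ∈ Finset.range n, onTime T R I T (tailSeq T R I x w i)) / n)
    atTop (𝓝 (∫ w, onTime T R I T w ∂iid (eventLaw r m))) at h1
  change Tendsto (fun n : ℕ => (∑ i ∈ Finset.range n, offTime T R I T (tailSeq T R I x w i)) / n)
    atTop (𝓝 (∫ w, offTime T R I T w ∂iid (eventLaw r m))) at h2
  rw [hon.2] at h1
  rw [hoff.2] at h2
  have hconst : ∀ c : ℝ, Tendsto (fun n : ℕ => c / (n : ℝ)) atTop (𝓝 0) := fun c =>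
    tendsto_const_nhds.div_atTop tendsto_natCast_atTop_atTop
  have hfin : ∀ t, volume {u | u ∈ Set.Icc 0 t ∧ Cached T R I x w u} ≠ ∞ := fun t =>
    measure_ne_top_of_subset (fun u hu => hu.1) (by simp : volume (Set.Icc 0 t) ≠ ∞)
  refine tendsto_div_of_tendsto_cycles (M := insTime T R I x w) (fun s t _ hst => ?_)
    measureReal_nonneg (insTime_monotone x w) ?_ ?_ ?_
  · exact measureReal_mono (fun u hu => ⟨⟨hu.1.1, hu.1.2.trans hst⟩, hu.2⟩) (hfin t)
  · have := meanOn_nonneg (T := T) (mul_pos hr hRpos) hT.le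
    positivity
  -- The initial cycle has a different law, but its fixed length vanishes after division by `n`.
  · have h3 := (hconst (onTime T R I x w + offTime T R I x w)).add (h2.add h1)
    rw [zero_add] at h3
    refine h3.congr fun n => ?_
    rw [insTime, Finset.sum_add_distrib]
    ring
  · have h3 := (hconst (onTime T R I x w)).add h1
    rw [zero_add] at h3
    refine h3.congr fun n => ?_
    have e : volume.real {u | u ∈ Set.Icc 0 (insTime T R I x w n) ∧ Cached T R I x w u} =
        onTime T R I x w + ∑ j ∈ Finset.range n, onTime T R I T (tailSeq T R I x w j) := by
      have h4 : ({u | u ∈ Set.Icc 0 (insTime T R I x w n) ∧ Cached T R I x w u} : Set ℝ)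
          =ᵐ[volume] {u | u ∈ Set.Ico 0 (insTime T R I x w n) ∧ Cached T R I x w u} :=
        (Ico_ae_eq_Icc (a := (0 : ℝ))).symm.inter (ae_eq_refl {u | Cached T R I x w u})
      rw [measureReal_congr h4, measureReal_def, hreg.volume_cached hT hx n,
        ENNReal.toReal_ofReal (add_nonneg (onTime_nonneg _ _)
          (Finset.sum_nonneg fun j _ => onTime_nonneg _ _))]
    rw [e]
    ring

end

end TTLChain

/-! ### Renewal equation with exponential kernel, and averages of convergent functions. -/

open scoped ENNReal

/-- A bounded solution of a renewal equation with exponential kernel and integrable forcing `e`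
vanishing at infinity converges. -/
lemma exists_tendsto_of_exponential_renewal {r : ℝ} {p e : ℝ → ℝ}
    (hp : Measurable p) (hp1 : ∀ t, ‖p t‖ ≤ 1) (he : IntegrableOn e (Set.Ioi 0))
    (he0 : Tendsto e atTop (𝓝 0))
    (hren : ∀ t, 0 ≤ t → p t = e t + ∫ u in (0 : ℝ)..t, r * Real.exp (-(r * (t - u))) * p u) :
    ∃ l, Tendsto p atTop (𝓝 l) := by
  have hpi : ∀ (c : ℝ → ℝ) (a b : ℝ), Continuous c →
      IntervalIntegrable (fun u => c u * p u) volume a b := fun c a b hc =>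
    IntervalIntegrable.continuousOn_mul
      ((intervalIntegrable_const (c := (1 : ℝ))).mono_fun hp.aestronglyMeasurable
        (.of_forall fun u => by simpa using hp1 u)) hc.continuousOn
  set φ : ℝ → ℝ := fun u => r * Real.exp (r * u) * p u with hφ
  have hφi : ∀ a b, IntervalIntegrable φ volume a b := fun a b => hpi _ a b (by fun_prop)
  set F : ℝ → ℝ := fun t => ∫ u in (0 : ℝ)..t, φ u with hF
  set D : ℝ → ℝ := fun t => Real.exp (-(r * t)) with hD
  have hFD : ∀ t, ∫ u in (0 : ℝ)..t, r * Real.exp (-(r * (t - u))) * p u = D t * F t := fun t => by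
    rw [hF, hD, ← intervalIntegral.integral_const_mul]
    refine intervalIntegral.integral_congr fun u _ => ?_
    simp only [hφ]
    rw [show -(r * (t - u)) = -(r * t) + r * u by ring, Real.exp_add]
    ring
  have hDd : ∀ t, HasDerivAt D (-(r * D t)) t := fun t => hasDerivAt_exp_neg_mul r t
  -- Almost everywhere $(DF)'=rp-rDF=re$, by the renewal equation. As `p` is merely measurable, `F`
  -- is only absolutely continuous, hence the product rule in that class.
  have hint : ∀ t, 0 ≤ t → D t * F t = ∫ u in (0 : ℝ)..t, r * e u := fun t ht => by
    have hF_ac : AbsolutelyContinuousOnInterval F 0 t :=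
      (hφi 0 t).absolutelyContinuousOnInterval_intervalIntegral (c := 0) (by simp)
    have hD_ac : AbsolutelyContinuousOnInterval D 0 t := by
      have hDc : ContDiff ℝ 1 D := by simp only [hD]; fun_prop
      exact hDc.contDiffOn.absolutelyContinuousOnInterval
    have h0 : F 0 = 0 := intervalIntegral.integral_same
    have h1 := hD_ac.integral_deriv_mul_eq_sub hF_ac
    rw [h0, mul_zero, sub_zero] at h1
    rw [← h1]
    refine intervalIntegral.integral_congr_ae ?_
    filter_upwards [(hφi 0 t).ae_hasDerivAt_integral] with u hu hut
    have hu' := (hu (Set.uIoc_subset_uIcc hut) 0 (by simp)).deriv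
    have hu0 : 0 ≤ u := by
      rw [Set.uIoc_of_le ht] at hut
      exact hut.1.le
    have h2 := hren u hu0
    rw [hFD] at h2
    have h3 : D u * Real.exp (r * u) = 1 := by
      simp only [hD]; rw [← Real.exp_add]; simp
    change deriv D u * F u + D u * deriv F u = r * e u
    rw [hu', (hDd u).deriv, hφ]
    linear_combination r * p u * h3 + r * h2
  refine ⟨∫ u in Set.Ioi (0 : ℝ), r * e u, ?_⟩
  have h1 := he0.add (intervalIntegral_tendsto_integral_Ioi 0 (he.const_mul r) tendsto_id)
  rw [zero_add] at h1
  refine h1.congr' ?_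
  filter_upwards [eventually_ge_atTop 0] with t ht
  rw [hren t ht, hFD, hint t ht]
  rfl

/-- The averages of a bounded convergent function converge to its limit. -/
lemma tendsto_integral_div_of_tendsto {p : ℝ → ℝ} (hp : Measurable p) (hp1 : ∀ t, ‖p t‖ ≤ 1)
    {l : ℝ} (hl : Tendsto p atTop (𝓝 l)) :
    Tendsto (fun n : ℕ => (∫ u in (0 : ℝ)..n, p u) / n) atTop (𝓝 l) := by
  -- Rescale $[0,n]$ to $[0,1]$: the integrand converges pointwise for `s > 0` and is bounded by
  -- `1`.
  have h1 : Tendsto (fun n : ℕ => ∫ s in (0 : ℝ)..1, p (n * s)) atTop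
      (𝓝 (∫ _ in (0 : ℝ)..1, l)) := by
    refine intervalIntegral.tendsto_integral_filter_of_dominated_convergence (fun _ => 1)
      (.of_forall fun n => (hp.comp (measurable_const_mul _)).aestronglyMeasurable)
      (.of_forall fun n => .of_forall fun s _ => hp1 _) (by simp) (.of_forall fun s hs => ?_)
    rw [Set.uIoc_of_le zero_le_one] at hs
    exact hl.comp (tendsto_natCast_atTop_atTop.atTop_mul_const hs.1)
  rw [intervalIntegral.integral_const, sub_zero, one_smul] at h1
  refine h1.congr' ?_
  filter_upwards [eventually_gt_atTop 0] with n hn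
  have hn' : (n : ℝ) ≠ 0 := by positivity
  rw [intervalIntegral.integral_comp_mul_left _ hn', smul_eq_mul, mul_zero, mul_one]
  field_simp

/-! ### Coupling, and convergence of the probability of being cached. -/

namespace TTLChain

open IIDSeq

noncomputable section

variable {E : Type*}

/-- The transitions during which every timer runs out. -/
def longGap (T : ℝ) : Set (Unit × (ℝ × E)) := {p | T ≤ p.2.1}

/-- The length of the time between two events. -/
def gapReward (_ : Unit) (z : ℝ × E) : ℝ := max z.1 0

/-- A gap of length at least `T` exhausts any timer in $[0,T]$; at the event ending it the new timer
is decided by the mark alone, so paths from `x` and `y` agree from then on. -/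
lemma cached_iff_of_longGap {T : ℝ} (hT : 0 ≤ T) {R I : Set E} {k : ℕ} {w : ℕ → ℝ × E}
    (hw : ∀ k, 0 ≤ (w k).1) (h : KilledAt (fun _ _ => ()) (longGap T) k () w) {x y : ℝ}
    (hx : x ∈ Set.Icc 0 T) (hy : y ∈ Set.Icc 0 T) {t : ℝ}
    (ht : partialReward (fun _ _ => ()) gapReward (k + 1) () w ≤ t) :
    Cached T R I x w t ↔ Cached T R I y w t := by
  induction k generalizing w x y t with
  | zero =>
    have h0 : T ≤ (w 0).1 := h
    have ht' : (w 0).1 ≤ t := by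
      rw [partialReward_succ] at ht
      simpa [partialReward, gapReward, hw 0] using ht
    have e : ∀ {x}, x ∈ Set.Icc 0 T → step T R I x (w 0) = step T R I 0 (w 0) := fun {x} hx => by
      have h1 : ¬ 0 < x - (w 0).1 := by linarith [hx.2]
      have h2 : ¬ 0 < 0 - (w 0).1 := by linarith [hw 0]
      simp only [step, if_neg h1, if_neg h2]
    rw [cached_iff hw, cached_iff hw, e hx, e hy]
    refine or_congr ⟨fun h => ?_, fun h => ?_⟩ Iff.rfl <;> linarith [h.2.1]
  | succ k ih =>
    have hw' : ∀ k, 0 ≤ (shift 1 w k).1 := fun k => hw (k + 1)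
    rw [partialReward_succ] at ht
    have hg : gapReward () (w 0) = (w 0).1 := max_eq_left (hw 0)
    rw [hg] at ht
    have h0 : 0 ≤ partialReward (fun _ _ => ()) gapReward (k + 1) () (shift 1 w) :=
      Finset.sum_nonneg fun i _ => le_max_right _ _
    rw [cached_iff hw, cached_iff hw,
      ih hw' h.2 (step_mem_Icc hT R I hx (hw 0)) (step_mem_Icc hT R I hy (hw 0)) (by linarith)]
    refine or_congr ⟨fun h => ?_, fun h => ?_⟩ Iff.rfl <;> linarith [h.2.1]

/-- The end of the first event-free period of length at least `T` after the first event. -/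
def couplingTime (T : ℝ) (w : ℕ → ℝ × E) : ℝ :=
  max (w 0).1 0 + totalReward (fun _ _ => ()) (longGap T) gapReward () (shift 1 w)

lemma totalReward_gapReward_nonneg (T : ℝ) (w : ℕ → ℝ × E) :
    0 ≤ totalReward (fun _ _ => ()) (longGap T) gapReward () w := by
  unfold totalReward partialReward
  exact Finset.sum_nonneg fun i _ => le_max_right _ _

lemma couplingTime_nonneg (T : ℝ) (w : ℕ → ℝ × E) : 0 ≤ couplingTime T w :=
  add_nonneg (le_max_right _ _) (totalReward_gapReward_nonneg T _)

/-- After the first event the timer is `step T R I x (w 0)` rather than `x`. A long gap in the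
shifted sequence makes the difference invisible, which is why `couplingTime` looks for it only after
the first event. -/
lemma cached_iff_of_couplingTime_le {T : ℝ} (hT : 0 ≤ T) {R I : Set E} {w : ℕ → ℝ × E}
    (hw : ∀ k, 0 ≤ (w k).1)
    (h : ∃ k, KilledAt (fun _ _ => ()) (longGap T) k () (shift 1 w)) {x : ℝ}
    (hx : x ∈ Set.Icc 0 T) {t : ℝ} (ht : couplingTime T w ≤ t) :
    Cached T R I x w t ↔ (w 0).1 ≤ t ∧ Cached T R I x (shift 1 w) (t - (w 0).1) := by
  have h0 := totalReward_gapReward_nonneg T (shift 1 w)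
  obtain ⟨k, hk⟩ := h
  rw [couplingTime, max_eq_left (hw 0)] at ht
  rw [cached_iff hw, cached_iff_of_longGap hT (w := shift 1 w) (fun k => hw (k + 1)) hk
    (step_mem_Icc hT R I hx (hw 0)) hx]
  · exact ⟨fun h => h.elim (fun h => by linarith [h.2.1]) id, .inr⟩
  · rw [totalReward, hk.killIndex_eq] at ht
    linarith

variable [MeasurableSpace E]

lemma measurableSet_longGap (T : ℝ) : MeasurableSet (longGap (E := E) T) :=
  measurableSet_le measurable_const (by fun_prop)

lemma measurable_gapReward : Measurable (Function.uncurry (gapReward (E := E))) := by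
  unfold gapReward Function.uncurry; fun_prop

lemma measurable_couplingTime (T : ℝ) : Measurable (couplingTime (E := E) T) :=
  (((measurable_fst.comp (measurable_pi_apply 0)).max measurable_const)).add
    ((measurable_totalReward measurable_const (measurableSet_longGap T) measurable_gapReward ()).comp
      (measurable_shift 1))

variable {T r : ℝ} {m : Measure E} {R I : Set E}

lemma measurableSet_cached (hR : MeasurableSet R) (hI : MeasurableSet I) (x : ℝ) :
    MeasurableSet {p : (ℕ → ℝ × E) × ℝ | Cached T R I x p.1 p.2} := by
  have ha : ∀ k, Measurable fun p : (ℕ → ℝ × E) × ℝ => arrival k p.1 := fun k =>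
    Finset.measurable_sum _ fun i _ =>
      measurable_fst.comp ((measurable_pi_apply i).comp measurable_fst)
  have hst : ∀ k, Measurable fun p : (ℕ → ℝ × E) × ℝ => state (step T R I) k x p.1 := fun k =>
    ((measurable_state (measurable_step hR hI) k).comp measurable_prodMk_left).comp measurable_fst
  have : {p : (ℕ → ℝ × E) × ℝ | Cached T R I x p.1 p.2} =
      ⋃ k, ({p | arrival k p.1 ≤ p.2} ∩ ({p | p.2 < arrival (k + 1) p.1} ∩
        {p | 0 < state (step T R I) k x p.1 - (p.2 - arrival k p.1)})) := by
    ext p; simp [Cached]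
  rw [this]
  exact .iUnion fun k => (measurableSet_le (ha k) measurable_snd).inter
    ((measurableSet_lt measurable_snd (ha (k + 1))).inter
      (measurableSet_lt measurable_const ((hst k).sub (measurable_snd.sub (ha k)))))

/-- The probability that the item is in the cache at time `t`. -/
def cachedProb (T r : ℝ) (m : Measure E) [IsProbabilityMeasure (eventLaw r m)] (R I : Set E)
    (x t : ℝ) : ℝ :=
  (iid (eventLaw r m)).real {w | Cached T R I x w t}

lemma measurable_cachedProb [IsProbabilityMeasure (eventLaw r m)] (hR : MeasurableSet R) (hI : MeasurableSet I) (x : ℝ) :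
    Measurable (cachedProb T r m R I x) :=
  (measurable_measure_prodMk_right (measurableSet_cached hR hI x)).ennreal_toReal

lemma norm_cachedProb_le [IsProbabilityMeasure (eventLaw r m)] (x t : ℝ) : ‖cachedProb T r m R I x t‖ ≤ 1 := by
  rw [cachedProb, Real.norm_of_nonneg measureReal_nonneg]
  exact measureReal_le_one

variable [IsProbabilityMeasure m]

/-- The factor `1` is written out to match `ofReal_one_sub_lt_one`. -/
lemma prod_notMem_longGap (hr : 0 < r) (hT : 0 ≤ T) :
    eventLaw r m {z | ((), z) ∉ longGap T} = ENNReal.ofReal (1 - 1 * Real.exp (-(r * T))) := by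
  have := isProbabilityMeasure_expMeasure hr
  have e : {z : ℝ × E | ((), z) ∉ longGap T} = (Set.Ici T)ᶜ ×ˢ Set.univ := by
    ext z; simp [longGap]
  rw [e, Measure.prod_prod, measure_univ, mul_one, prob_compl_eq_one_sub measurableSet_Ici,
    expMeasure_Ici hr hT, one_mul, ENNReal.ofReal_sub _ (Real.exp_nonneg _), ENNReal.ofReal_one]

lemma lintegral_gapReward (hr : 0 < r) :
    ∫⁻ z : ℝ × E, ENNReal.ofReal (gapReward () z) ∂eventLaw r m = ENNReal.ofReal (1 / r) := by
  have := isProbabilityMeasure_expMeasure hr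
  have e : ∀ z : ℝ × E, ENNReal.ofReal (gapReward () z) = ENNReal.ofReal (z.1 - 0) := fun z => by
    simp [gapReward, ENNReal.ofReal_max]
  rw [lintegral_congr e, lintegral_prod _ (by fun_prop)]
  simpa using lintegral_expMeasure_sub hr le_rfl

lemma ae_killedAt_longGap [IsProbabilityMeasure (eventLaw r m)] (hr : 0 < r) (hT : 0 ≤ T) :
    ∀ᵐ w ∂iid (eventLaw r m), ∃ k, KilledAt (fun _ _ => ()) (longGap T) k () w :=
  ae_exists_killedAt (I := Set.univ) measurable_const (measurableSet_longGap T)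
    (fun _ _ => .of_forall fun _ => trivial) (ofReal_one_sub_lt_one one_pos (-(r * T)))
    (fun _ _ => (prod_notMem_longGap hr hT).le) trivial

/-- With a one-point state space the one-step equation is $1/r+(1-e^{-rT})c=c$. -/
lemma lintegral_totalReward_gapReward [IsProbabilityMeasure (eventLaw r m)] (hr : 0 < r)
    (hT : 0 ≤ T) :
    ∫⁻ w, ENNReal.ofReal (totalReward (fun _ _ => ()) (longGap T) gapReward () w)
      ∂iid (eventLaw r m) = ENNReal.ofReal (Real.exp (r * T) / r) := by
  refine lintegral_totalReward (I := Set.univ) (φ := fun _ => ENNReal.ofReal (Real.exp (r * T) / r))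
    measurable_const (measurableSet_longGap T) measurable_gapReward (fun _ _ => le_max_right _ _)
    (fun _ _ => .of_forall fun _ => trivial) (ofReal_one_sub_lt_one one_pos (-(r * T)))
    (fun _ _ => (prod_notMem_longGap hr hT).le) ENNReal.ofReal_ne_top (fun _ => le_rfl)
    measurable_const (fun _ _ => ?_) trivial
  have hS : MeasurableSet {z : ℝ × E | ((), z) ∉ longGap T} :=
    measurable_prodMk_left (measurableSet_longGap T).compl
  have h1 : Real.exp (-(r * T)) ≤ 1 :=
    Real.exp_le_one_iff.2 (by have := mul_nonneg hr.le hT; linarith)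
  rw [lintegral_add_right _ (measurable_const.indicator hS), lintegral_indicator_const hS,
    prod_notMem_longGap hr hT, lintegral_gapReward hr, ← ENNReal.ofReal_mul (by positivity),
    ← ENNReal.ofReal_add (by positivity) (mul_nonneg (by positivity) (by linarith))]
  congr 1
  have h2 : Real.exp (r * T) * Real.exp (-(r * T)) = 1 := by rw [← Real.exp_add]; simp
  field_simp
  linear_combination -h2

lemma lintegral_couplingTime_ne_top [IsProbabilityMeasure (eventLaw r m)] (hr : 0 < r)
    (hT : 0 ≤ T) : ∫⁻ w, ENNReal.ofReal (couplingTime T w) ∂iid (eventLaw r m) ≠ ∞ := by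
  have h1 : ∫⁻ w, ENNReal.ofReal (gapReward () (w 0)) ∂iid (eventLaw r m) =
      ENNReal.ofReal (1 / r) := by
    rw [← lintegral_gapReward (m := m) hr]
    exact (measurePreserving_eval_infinitePi (fun _ : ℕ => eventLaw r m) 0).lintegral_comp
      (f := fun z => ENNReal.ofReal (gapReward () z))
      (measurable_fst.max measurable_const).ennreal_ofReal
  have h2 := (measurePreserving_shift (ν := eventLaw r m) 1).lintegral_comp
    (measurable_totalReward (s := fun _ _ => ()) measurable_const (measurableSet_longGap T)
      measurable_gapReward ()).ennreal_ofReal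
  have e : ∀ w : ℕ → ℝ × E, ENNReal.ofReal (couplingTime T w) =
      ENNReal.ofReal (gapReward () (w 0)) + ENNReal.ofReal
        (totalReward (fun _ _ => ()) (longGap T) gapReward () (shift 1 w)) := fun w =>
    ENNReal.ofReal_add (le_max_right _ _) (totalReward_gapReward_nonneg T _)
  rw [lintegral_congr e, lintegral_add_left, h1, h2, lintegral_totalReward_gapReward hr hT]
  · exact ENNReal.add_ne_top.2 ⟨ENNReal.ofReal_ne_top, ENNReal.ofReal_ne_top⟩
  · exact ((measurable_fst.comp (measurable_pi_apply 0)).max measurable_const).ennreal_ofReal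

variable [IsProbabilityMeasure (eventLaw r m)]

/-- Conditioning on the first event. -/
lemma iid_cached_shift (hr : 0 < r) (hR : MeasurableSet R) (hI : MeasurableSet I) (x : ℝ) {t : ℝ}
    (ht : 0 ≤ t) :
    (iid (eventLaw r m)).real
      {w | (w 0).1 ≤ t ∧ Cached T R I x (shift 1 w) (t - (w 0).1)} =
    ∫ u in (0 : ℝ)..t, r * Real.exp (-(r * (t - u))) * cachedProb T r m R I x u := by
  set p := cachedProb T r m R I x with hp
  have hpm : Measurable p := measurable_cachedProb hR hI x
  have hp0 : ∀ u, 0 ≤ p u := fun u => measureReal_nonneg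
  have hA : MeasurableSet {w : ℕ → ℝ × E | (w 0).1 ≤ t ∧
      Cached T R I x (shift 1 w) (t - (w 0).1)} := by
    have h0 : Measurable fun w : ℕ → ℝ × E => (w 0).1 := measurable_fst.comp (measurable_pi_apply 0)
    exact (measurableSet_le h0 measurable_const).inter
      (((measurable_shift 1).prodMk (measurable_const.sub h0)) (measurableSet_cached hR hI x))
  have hF : Measurable fun g => (Set.Iic t).indicator (fun g => ENNReal.ofReal (p (t - g))) g :=
    (hpm.comp (measurable_const.sub measurable_id)).ennreal_ofReal.indicator measurableSet_Iic
  have e1 : iid (eventLaw r m) {w | (w 0).1 ≤ t ∧ Cached T R I x (shift 1 w) (t - (w 0).1)} =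
      ∫⁻ g, (Set.Iic t).indicator (fun g => ENNReal.ofReal (p (t - g))) g ∂expMeasure r := by
    rw [iid_apply hA]
    have e2 : ∀ z : ℝ × E, iid (eventLaw r m) {w | cons z w ∈ {w : ℕ → ℝ × E | (w 0).1 ≤ t ∧
        Cached T R I x (shift 1 w) (t - (w 0).1)}} =
        (Set.Iic t).indicator (fun g => ENNReal.ofReal (p (t - g))) z.1 := fun z => by
      by_cases hz : z.1 ≤ t
      · rw [Set.indicator_of_mem (Set.mem_Iic.2 hz), hp, cachedProb, ofReal_measureReal]
        simp [hz]
      · rw [Set.indicator_of_notMem (s := Set.Iic t) hz]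
        simp [hz]
    rw [lintegral_congr e2, lintegral_prod
      (fun z : ℝ × E => (Set.Iic t).indicator (fun g => ENNReal.ofReal (p (t - g))) z.1)
      (hF.comp measurable_fst).aemeasurable]
    simp
  have hbd : ∀ u ∈ Set.Ioo 0 t, 0 ≤ r * Real.exp (-(r * u)) * p (t - u) := fun u _ =>
    mul_nonneg (by positivity) (hp0 _)
  have hint : IntegrableOn (fun g => r * Real.exp (-(r * g)) * p (t - g)) (Set.Ioo 0 t) := by
    have h1 : IntegrableOn (fun g => r * Real.exp (-(r * g))) (Set.Ioo 0 t) :=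
      ((by fun_prop : Continuous fun g => r * Real.exp (-(r * g))).integrableOn_Icc
        (a := 0) (b := t)).mono_set Set.Ioo_subset_Icc_self
    refine Integrable.mul_bdd (c := 1) h1
      (hpm.comp (measurable_const.sub measurable_id)).aestronglyMeasurable
      (.of_forall fun g => norm_cachedProb_le x _)
  have e3 : ∀ g, ENNReal.ofReal (r * Real.exp (-(r * g))) *
      (Set.Iic t).indicator (fun g => ENNReal.ofReal (p (t - g))) g =
      (Set.Iic t).indicator
        (fun g => ENNReal.ofReal (r * Real.exp (-(r * g)) * p (t - g))) g := fun g => by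
    by_cases hg : g ∈ Set.Iic t
    · rw [Set.indicator_of_mem hg, Set.indicator_of_mem hg,
        ENNReal.ofReal_mul (mul_nonneg hr.le (Real.exp_nonneg _))]
    · rw [Set.indicator_of_notMem hg, Set.indicator_of_notMem hg, mul_zero]
  rw [measureReal_def, e1, lintegral_expMeasure r hF, lintegral_congr e3,
    lintegral_indicator measurableSet_Iic, Measure.restrict_restrict measurableSet_Iic,
    Set.inter_comm, Set.Ioi_inter_Iic, setLIntegral_congr Ioo_ae_eq_Ioc.symm,
    ← ofReal_integral_eq_lintegral_ofReal hint
      ((ae_restrict_iff' measurableSet_Ioo).2 (.of_forall hbd)),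
    ENNReal.toReal_ofReal (setIntegral_nonneg measurableSet_Ioo hbd),
    ← integral_Ioc_eq_integral_Ioo, ← intervalIntegral.integral_of_le ht]
  -- Substitute `u = t - g`, from the first gap to the time remaining after it.
  have h2 := intervalIntegral.integral_comp_sub_left
    (f := fun u => r * Real.exp (-(r * (t - u))) * p u) (a := 0) (b := t) t
  rw [sub_self, sub_zero] at h2
  rw [← h2]
  simp

/-- The probability that the item is in the cache converges. -/
theorem exists_tendsto_cachedProb (hr : 0 < r) (hT : 0 < T) (hR : MeasurableSet R)
    (hI : MeasurableSet I) {x : ℝ} (hx : x ∈ Set.Icc 0 T) :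
    ∃ l, Tendsto (cachedProb T r m R I x) atTop (𝓝 l) := by
  set P := iid (eventLaw r m) with hP
  set p := cachedProb T r m R I x with hp
  have hpm : Measurable p := measurable_cachedProb hR hI x
  -- The renewal equation holds by definition of `e`; what has to be proved is that `e` is
  -- integrable and vanishes at infinity, both by domination with the tail `h` of the coupling time.
  set e : ℝ → ℝ := fun t =>
    p t - ∫ u in (0 : ℝ)..t, r * Real.exp (-(r * (t - u))) * p u with he
  set h : ℝ → ℝ := fun t => P.real {w | t < couplingTime T w} with hh
  have hHm := measurable_couplingTime (E := E) T
  have hanti : Antitone h := fun s t hst =>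
    measureReal_mono fun w (hw : t < couplingTime T w) => hst.trans_lt hw
  -- Layer cake: the integral of the tail is the mean coupling time, which is finite.
  have hlay := lintegral_eq_lintegral_meas_lt P (.of_forall (couplingTime_nonneg T))
    hHm.aemeasurable
  have hfin := lintegral_couplingTime_ne_top (T := T) (m := m) hr hT.le
  have hhi : IntegrableOn h (Set.Ioi 0) := by
    refine ⟨hanti.measurable.aestronglyMeasurable, ?_⟩
    rw [hasFiniteIntegral_iff_ofReal (.of_forall fun t => measureReal_nonneg)]
    have e1 : ∀ t, ENNReal.ofReal (h t) = P {w | t < couplingTime T w} := fun t =>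
      ofReal_measureReal
    rw [lintegral_congr e1, ← hlay]
    exact hfin.lt_top
  have hh0 : Tendsto h atTop (𝓝 0) := by
    set C := (∫⁻ w, ENNReal.ofReal (couplingTime T w) ∂P).toReal with hC
    have h1 : Tendsto (fun t : ℝ => C / t) atTop (𝓝 0) :=
      tendsto_const_nhds.div_atTop tendsto_id
    refine squeeze_zero' (.of_forall fun t => measureReal_nonneg) ?_ h1
    filter_upwards [eventually_gt_atTop 0] with t ht
    -- Markov's inequality bounds the tail by `C / t`.
    have h2 := meas_ge_le_lintegral_div (μ := P) hHm.ennreal_ofReal.aemeasurable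
      (ε := ENNReal.ofReal t) (by simpa using ht) ENNReal.ofReal_ne_top
    have h3 : P {w | t < couplingTime T w} ≤
        (∫⁻ w, ENNReal.ofReal (couplingTime T w) ∂P) / ENNReal.ofReal t :=
      (measure_mono fun w (hw : t < couplingTime T w) => ENNReal.ofReal_le_ofReal hw.le).trans h2
    have h4 := ENNReal.toReal_mono (ENNReal.div_ne_top hfin (by simpa using ht)) h3
    rwa [ENNReal.toReal_div, ENNReal.toReal_ofReal ht.le] at h4
  -- By `iid_cached_shift` the convolution is the probability of `B`, and `A` and `B` differ only,
  -- up to a null set, where coupling has not yet occurred.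
  have hbound : ∀ t, 0 ≤ t → ‖e t‖ ≤ h t := fun t ht => by
    change ‖p t - ∫ u in (0 : ℝ)..t, r * Real.exp (-(r * (t - u))) * p u‖ ≤ h t
    rw [hp, ← iid_cached_shift hr hR hI x ht, cachedProb]
    set A := {w : ℕ → ℝ × E | Cached T R I x w t} with hA
    set B := {w : ℕ → ℝ × E | (w 0).1 ≤ t ∧ Cached T R I x (shift 1 w) (t - (w 0).1)} with hB
    have hAB : ∀ᵐ w ∂P, ¬ t < couplingTime T w → (w ∈ A ↔ w ∈ B) := by
      filter_upwards [ae_forall_pos (r := r) (m := m),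
        (measurePreserving_shift (ν := eventLaw r m) 1).quasiMeasurePreserving.ae
          (ae_killedAt_longGap (T := T) hr hT.le)] with w h1 h2 h3
      exact cached_iff_of_couplingTime_le hT.le (fun k => (h1 k).le) h2 hx (not_lt.1 h3)
    have key : ∀ A B : Set (ℕ → ℝ × E), (∀ᵐ w ∂P, ¬ t < couplingTime T w → (w ∈ A → w ∈ B)) →
        P.real A ≤ P.real B + h t := fun A B hAB => by
      refine le_trans (ENNReal.toReal_mono (measure_ne_top P _) (measure_mono_ae
        (t := B ∪ {w | t < couplingTime T w}) ?_)) (measureReal_union_le _ _)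
      filter_upwards [hAB] with w h1 h2
      by_cases h3 : t < couplingTime T w
      · exact .inr h3
      · exact .inl (h1 h3 h2)
    have h1 := key A B (hAB.mono fun w h1 h2 => (h1 h2).1)
    have h2 := key B A (hAB.mono fun w h1 h2 => (h1 h2).2)
    rw [Real.norm_eq_abs, abs_le]
    constructor <;> linarith
  have hem : AEStronglyMeasurable e (volume.restrict (Set.Ioi 0)) := by
    have hc : ContinuousOn (fun t => ∫ u in (0 : ℝ)..t,
        r * Real.exp (-(r * (t - u))) * p u) Set.univ := by
      -- Factoring out $e^{-rt}$ leaves a primitive, so the convolution is continuous in `t`.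
      have h1 : ∀ t, ∫ u in (0 : ℝ)..t, r * Real.exp (-(r * (t - u))) * p u =
          Real.exp (-(r * t)) * ∫ u in (0 : ℝ)..t, r * Real.exp (r * u) * p u := fun t => by
        rw [← intervalIntegral.integral_const_mul]
        refine intervalIntegral.integral_congr fun u _ => ?_
        rw [show -(r * (t - u)) = -(r * t) + r * u by ring, Real.exp_add]
        ring
      simp only [h1]
      have h2 : Continuous fun t => ∫ u in (0 : ℝ)..t, r * Real.exp (r * u) * p u :=
        intervalIntegral.continuous_primitive (fun a b => IntervalIntegrable.continuousOn_mul
          ((intervalIntegrable_const (c := (1 : ℝ))).mono_fun hpm.aestronglyMeasurable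
            (.of_forall fun u => by simpa using norm_cachedProb_le x u))
          (by fun_prop : Continuous fun u => r * Real.exp (r * u)).continuousOn) 0
      exact (by fun_prop : Continuous fun t => Real.exp (-(r * t)) * _).continuousOn
    exact hpm.aestronglyMeasurable.sub
      (continuousOn_univ.1 hc).measurable.aestronglyMeasurable
  refine exists_tendsto_of_exponential_renewal (r := r) (e := e) hpm (norm_cachedProb_le x)
    (hhi.mono' hem ((ae_restrict_iff' measurableSet_Ioi).2
      (.of_forall fun t ht => hbound t (le_of_lt ht)))) ?_ fun t _ => ?_
  · refine squeeze_zero_norm' ?_ hh0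
    filter_upwards [eventually_ge_atTop 0] with t ht using hbound t ht
  · change p t = (p t - ∫ u in (0 : ℝ)..t, r * Real.exp (-(r * (t - u))) * p u) + _
    ring

/-- The probability that the item is in the cache converges to the long-run fraction of time in
the cache. -/
theorem tendsto_cachedProb (hr : 0 < r) (hT : 0 < T) (hR : MeasurableSet R)
    (hI : MeasurableSet I) {x : ℝ} (hx : x ∈ Set.Icc 0 T) {o : ℝ}
    (ho : ∀ᵐ w ∂iid (eventLaw r m), Tendsto
      (fun t : ℝ => volume.real {u | u ∈ Set.Icc 0 t ∧ Cached T R I x w u} / t) atTop (𝓝 o)) :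
    Tendsto (cachedProb T r m R I x) atTop (𝓝 o) := by
  set P := iid (eventLaw r m) with hP
  -- Existence of the limit is known; its value follows by computing the averages of `p` over
  -- $[0,n]$ in two ways.
  obtain ⟨l, hl⟩ := exists_tendsto_cachedProb (m := m) hr hT hR hI hx
  have h1 := tendsto_integral_div_of_tendsto (measurable_cachedProb hR hI x)
    (norm_cachedProb_le x) hl
  have hA : ∀ n : ℕ, MeasurableSet
      {q : (ℕ → ℝ × E) × ℝ | q.2 ∈ Set.Icc (0 : ℝ) n ∧ Cached T R I x q.1 q.2} := fun n =>
    (measurable_snd measurableSet_Icc).inter (measurableSet_cached hR hI x)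
  have hOm : ∀ n : ℕ, Measurable fun w =>
      volume {u | u ∈ Set.Icc (0 : ℝ) n ∧ Cached T R I x w u} := fun n =>
    measurable_measure_prodMk_left (hA n)
  have hOle : ∀ (n : ℕ) w,
      volume {u | u ∈ Set.Icc (0 : ℝ) n ∧ Cached T R I x w u} ≤ ENNReal.ofReal n := fun n w =>
    (measure_mono fun u hu => hu.1).trans (by simp [Real.volume_Icc])
  have h2 : ∀ n : ℕ, ∫ w, volume.real {u | u ∈ Set.Icc (0 : ℝ) n ∧ Cached T R I x w u} ∂P =
      ∫ u in (0 : ℝ)..n, cachedProb T r m R I x u := fun n => by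
    -- Fubini: the expected time in the cache during $[0,n]$ is the integral of the probability of
    -- being cached.
    have h3 := (Measure.prod_apply (μ := P) (ν := volume) (hA n)).symm.trans
      (Measure.prod_apply_symm (hA n))
    have e : ∀ u : ℝ, P ((fun w => (w, u)) ⁻¹'
        {q : (ℕ → ℝ × E) × ℝ | q.2 ∈ Set.Icc (0 : ℝ) n ∧ Cached T R I x q.1 q.2}) =
        (Set.Icc (0 : ℝ) n).indicator (fun u => P {w | Cached T R I x w u}) u := fun u => by
      by_cases hu : u ∈ Set.Icc (0 : ℝ) n
      · rw [Set.indicator_of_mem hu]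
        congr 1
        ext w
        exact ⟨And.right, fun h => ⟨hu, h⟩⟩
      · rw [Set.indicator_of_notMem hu]
        refine measure_mono_null (fun w hw => hu hw.1) measure_empty
    rw [lintegral_congr e, lintegral_indicator measurableSet_Icc] at h3
    rw [intervalIntegral.integral_of_le n.cast_nonneg, ← integral_Icc_eq_integral_Ioc]
    have h4 := integral_toReal (hOm n).aemeasurable (μ := P)
      (.of_forall fun w => (hOle n w).trans_lt ENNReal.ofReal_lt_top)
    have h5 := integral_toReal (μ := volume.restrict (Set.Icc (0 : ℝ) n))
      (f := fun u => P {w | Cached T R I x w u})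
      (measurable_measure_prodMk_right (measurableSet_cached hR hI x)).aemeasurable
      (.of_forall fun u => measure_lt_top _ _)
    exact h4.trans ((congrArg ENNReal.toReal h3).trans h5.symm)
  -- The fractions are bounded by `1`, so the almost sure limit `o` passes to expectations.
  have h3 : Tendsto (fun n : ℕ => ∫ w,
      volume.real {u | u ∈ Set.Icc (0 : ℝ) n ∧ Cached T R I x w u} / n ∂P) atTop
      (𝓝 (∫ _, o ∂P)) := by
    refine tendsto_integral_of_dominated_convergence (fun _ => 1)
      (fun n => ((hOm n).ennreal_toReal.div_const _).aestronglyMeasurable)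
      (integrable_const 1) (fun n => .of_forall fun w => ?_) ?_
    · rw [Real.norm_of_nonneg (by positivity)]
      refine div_le_one_of_le₀ ?_ n.cast_nonneg
      have := ENNReal.toReal_mono ENNReal.ofReal_ne_top (hOle n w)
      rwa [ENNReal.toReal_ofReal n.cast_nonneg] at this
    · filter_upwards [ho] with w hw using hw.comp tendsto_natCast_atTop_atTop
  rw [integral_const, probReal_univ, one_smul] at h3
  have h4 : Tendsto (fun n : ℕ => (∫ u in (0 : ℝ)..n, cachedProb T r m R I x u) / n) atTop
      (𝓝 o) := h3.congr fun n => by rw [integral_div, h2]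
  rwa [← tendsto_nhds_unique h1 h4]

end

end TTLChain

/-! ### Transfer to the cache model. -/

namespace RNDTTLCache

open IIDSeq TTLChain

variable {ι E Ω : Type*} [MeasurableSpace Ω] [MeasurableSpace E] {μ : Measure Ω}

/-- The sequence of inter-event times and marks. -/
def eventSeq (C : RNDTTLCache ι E μ) (ω : Ω) (k : ℕ) : ℝ × E := (C.gap k ω, C.mark k ω)

lemma timer_eq_state (C : RNDTTLCache ι E μ) (n : ι) (k : ℕ) (ω : Ω) :
    C.timer n k ω =
      state (step C.T (C.refreshOn n) (C.insertOn n)) k (C.startTimer n) (C.eventSeq ω) := by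
  induction k with
  | zero => rfl
  | succ k ih => rw [state_succ, ← ih]; rfl

lemma mem_content_iff (C : RNDTTLCache ι E μ) (n : ι) (t : ℝ) (ω : Ω) :
    n ∈ C.content t ω ↔
      Cached C.T (C.refreshOn n) (C.insertOn n) (C.startTimer n) (C.eventSeq ω) t := by
  change (∃ k, _ ∧ _ ∧ 0 < C.timer n k ω - _) ↔ _
  simp only [timer_eq_state]
  rfl

lemma startTimer_mem_Icc (C : RNDTTLCache ι E μ) (n : ι) : C.startTimer n ∈ Set.Icc 0 C.T :=
  ⟨C.startTimer_nonneg n, C.startTimer_le n⟩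

/-- Through this map every statement about the i.i.d. sequence space pulls back to `Ω`. -/
lemma measurePreserving_eventSeq (C : RNDTTLCache ι E μ)
    [IsProbabilityMeasure (eventLaw C.rate C.markLaw)] :
    MeasurePreserving C.eventSeq μ (iid (eventLaw C.rate C.markLaw)) := by
  have hm : ∀ k, Measurable fun ω => (C.gap k ω, C.mark k ω) := fun k =>
    (C.measurable_gap k).prodMk (C.measurable_mark k)
  refine ⟨measurable_pi_iff.2 hm, ?_⟩
  refine (C.iIndepFun_gap_mark.map_fun_eq_infinitePi_map hm).trans ?_
  simp only [C.map_gap_mark]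

lemma nextIn_eq (C : RNDTTLCache ι E μ) (n : ι) (s : ℝ) (ω : Ω) :
    C.nextIn n s ω = sInf {t | s ≤ t ∧
    Cached C.T (C.refreshOn n) (C.insertOn n) (C.startTimer n) (C.eventSeq ω) t} := by
  simp only [nextIn, mem_content_iff]

lemma nextOut_eq (C : RNDTTLCache ι E μ) (n : ι) (s : ℝ) (ω : Ω) :
    C.nextOut n s ω = sInf {t | s ≤ t ∧
    ¬ Cached C.T (C.refreshOn n) (C.insertOn n) (C.startTimer n) (C.eventSeq ω) t} := by
  simp only [nextOut, mem_content_iff]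

lemma cycleStart_zero_eq {C : RNDTTLCache ι E μ} {n : ι} {ω : Ω}
    (h : FullyRegular C.T (C.refreshOn n) (C.insertOn n) (C.startTimer n) (C.eventSeq ω)) :
    C.cycleStart n 0 ω =
      onTime C.T (C.refreshOn n) (C.insertOn n) (C.startTimer n) (C.eventSeq ω) := by
  rw [cycleStart, nextOut_eq]
  exact h.sInf_start_out C.T_pos (C.startTimer_mem_Icc n)

lemma insertionTime_eq {C : RNDTTLCache ι E μ} {n : ι} {ω : Ω}
    (h : FullyRegular C.T (C.refreshOn n) (C.insertOn n) (C.startTimer n) (C.eventSeq ω))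
    (j : ℕ) : C.insertionTime n j ω =
    insTime C.T (C.refreshOn n) (C.insertOn n) (C.startTimer n) (C.eventSeq ω) j := by
  induction j with
  | zero =>
    rw [insertionTime, cycleStart_zero_eq h, nextIn_eq]
    exact h.sInf_start_in C.T_pos (C.startTimer_mem_Icc n)
  | succ j ih =>
    rw [insertionTime, cycleStart]
    change C.nextIn n (C.nextOut n (C.insertionTime n j ω) ω) ω = _
    rw [ih, nextOut_eq, h.sInf_out C.T_pos (C.startTimer_mem_Icc n), nextIn_eq,
      h.sInf_in C.T_pos (C.startTimer_mem_Icc n)]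

lemma cycleStart_succ_eq {C : RNDTTLCache ι E μ} {n : ι} {ω : Ω}
    (h : FullyRegular C.T (C.refreshOn n) (C.insertOn n) (C.startTimer n) (C.eventSeq ω))
    (j : ℕ) : C.cycleStart n (j + 1) ω =
    insTime C.T (C.refreshOn n) (C.insertOn n) (C.startTimer n) (C.eventSeq ω) j +
      onTime C.T (C.refreshOn n) (C.insertOn n) C.T
        (tailSeq C.T (C.refreshOn n) (C.insertOn n) (C.startTimer n) (C.eventSeq ω) j) := by
  change C.nextOut n (C.insertionTime n j ω) ω = _
  rw [insertionTime_eq h, nextOut_eq, h.sInf_out C.T_pos (C.startTimer_mem_Icc n)]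

/-- Every on period, including the one in cycle `0`, begins at an insertion, hence with timer `T`.
-/
lemma Ton_eq {C : RNDTTLCache ι E μ} {n : ι} {ω : Ω}
    (h : FullyRegular C.T (C.refreshOn n) (C.insertOn n) (C.startTimer n) (C.eventSeq ω))
    (j : ℕ) : C.Ton n j ω = onTime C.T (C.refreshOn n) (C.insertOn n) C.T
    (tailSeq C.T (C.refreshOn n) (C.insertOn n) (C.startTimer n) (C.eventSeq ω) j) := by
  rw [Ton, cycleStart_succ_eq h, insertionTime_eq h, add_sub_cancel_left]

lemma Toff_zero_eq {C : RNDTTLCache ι E μ} {n : ι} {ω : Ω}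
    (h : FullyRegular C.T (C.refreshOn n) (C.insertOn n) (C.startTimer n) (C.eventSeq ω)) :
    C.Toff n 0 ω =
      offTime C.T (C.refreshOn n) (C.insertOn n) (C.startTimer n) (C.eventSeq ω) := by
  rw [Toff, cycleStart_zero_eq h, insertionTime_eq h]
  simp [insTime]

lemma Toff_succ_eq {C : RNDTTLCache ι E μ} {n : ι} {ω : Ω}
    (h : FullyRegular C.T (C.refreshOn n) (C.insertOn n) (C.startTimer n) (C.eventSeq ω))
    (j : ℕ) : C.Toff n (j + 1) ω = offTime C.T (C.refreshOn n) (C.insertOn n) C.T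
    (tailSeq C.T (C.refreshOn n) (C.insertOn n) (C.startTimer n) (C.eventSeq ω) j) := by
  rw [Toff, cycleStart_succ_eq h, insertionTime_eq h, insTime_succ, add_sub_cancel_left]

end RNDTTLCache

lemma MeasureTheory.MeasurePreserving.integrable_and_integral_of_ae_eq {Ω W : Type*}
    [MeasurableSpace Ω] [MeasurableSpace W] {μ : Measure Ω} {P : Measure W} {g : Ω → W}
    (hg : MeasurePreserving g μ P) {f : W → ℝ} (hf : Measurable f) {c : ℝ}
    (h : Integrable f P ∧ ∫ w, f w ∂P = c) {X : Ω → ℝ} (hX : ∀ᵐ ω ∂μ, X ω = f (g ω)) :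
    Integrable X μ ∧ ∫ ω, X ω ∂μ = c := by
  refine ⟨(hg.integrable_comp_of_integrable h.1).congr (hX.mono fun ω h => h.symm), ?_⟩
  rw [integral_congr_ae hX, ← h.2, ← hg.map_eq]
  exact (integral_map hg.measurable.aemeasurable hf.aestronglyMeasurable).symm

open IIDSeq TTLChain

theorem mainTheorem2 {ι E Ω : Type*} [MeasurableSpace Ω] [MeasurableSpace E]
    {μ : Measure Ω} [IsProbabilityMeasure μ] (C : RNDTTLCache ι E μ) (n : ι)
    (hi : 0 < C.insertionRate n) (hr : 0 < C.refreshRate n) (j : ℕ) :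
    Integrable (C.Ton n j) μ ∧
    Integrable (C.Toff n j) μ ∧
    ∫ ω, C.Ton n j ω ∂μ = (Real.exp (C.refreshRate n * C.T) - 1) / C.refreshRate n ∧
    ∫ ω, C.Toff n j ω ∂μ = 1 / C.insertionRate n ∧
    C.IsSteadyStateOccupancy n
      ((∫ ω, C.Ton n j ω ∂μ) / ((∫ ω, C.Toff n j ω ∂μ) + ∫ ω, C.Ton n j ω ∂μ)) := by
  have := C.isProbabilityMeasure_markLaw
  have := isProbabilityMeasure_expMeasure C.rate_pos
  have : IsProbabilityMeasure (eventLaw C.rate C.markLaw) := inferInstance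
  have hseq := C.measurePreserving_eventSeq
  have hx := C.startTimer_mem_Icc n
  have hT := C.T_pos
  have hTT : C.T ∈ Set.Icc 0 C.T := ⟨hT.le, le_rfl⟩
  have hR := C.measurableSet_refreshOn n
  have hI := C.measurableSet_insertOn n
  have hRpos : 0 < C.markLaw.real (C.refreshOn n) := pos_of_mul_pos_right hr C.rate_pos.le
  have hIpos : 0 < C.markLaw.real (C.insertOn n) := pos_of_mul_pos_right hi C.rate_pos.le
  have hreg := hseq.quasiMeasurePreserving.ae
    (ae_fullyRegular (m := C.markLaw) C.rate_pos hT hR hI hIpos hx)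
  have htail : ∀ i, MeasurePreserving (fun ω => tailSeq C.T (C.refreshOn n) (C.insertOn n)
      (C.startTimer n) (C.eventSeq ω) i) μ (iid (eventLaw C.rate C.markLaw)) := fun i =>
    (measurePreserving_tailSeq C.rate_pos hT hR hI hIpos hx i).comp hseq
  have hon : Integrable (C.Ton n j) μ ∧
      ∫ ω, C.Ton n j ω ∂μ = (Real.exp (C.refreshRate n * C.T) - 1) / C.refreshRate n := by
    rw [← meanOn_self]
    exact (htail j).integrable_and_integral_of_ae_eq (measurable_onTime hR hI C.T)
      (onTime_integrable_and_integral C.rate_pos hT hR hI hRpos hIpos hTT)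
      (hreg.mono fun ω h => RNDTTLCache.Ton_eq h j)
  have hoff : Integrable (C.Toff n j) μ ∧ ∫ ω, C.Toff n j ω ∂μ = 1 / C.insertionRate n := by
    -- The off period of cycle `0` ends a path started from `startTimer`, the later ones end paths
    -- started from `T`; the mean off time is the same for every initial timer.
    cases j with
    | zero =>
      exact hseq.integrable_and_integral_of_ae_eq (measurable_offTime hR hI (C.startTimer n))
        (offTime_integrable_and_integral C.rate_pos hT hR hI hIpos hx)
        (hreg.mono fun ω h => RNDTTLCache.Toff_zero_eq h)
    | succ j =>
      exact (htail j).integrable_and_integral_of_ae_eq (measurable_offTime hR hI C.T)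
        (offTime_integrable_and_integral C.rate_pos hT hR hI hIpos hTT)
        (hreg.mono fun ω h => RNDTTLCache.Toff_succ_eq h j)
  refine ⟨hon.1, hoff.1, hon.2, hoff.2, ?_⟩
  rw [hon.2, hoff.2, ← meanOn_self]
  have hocc := ae_tendsto_occupancy (m := C.markLaw) C.rate_pos hT hR hI hRpos hIpos hx
  refine ⟨(tendsto_cachedProb C.rate_pos hT hR hI hx hocc).congr fun t => ?_, ?_⟩
  · have hA : MeasurableSet {w | Cached C.T (C.refreshOn n) (C.insertOn n) (C.startTimer n) w t} :=
      measurable_prodMk_right (measurableSet_cached hR hI (C.startTimer n))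
    simp only [RNDTTLCache.mem_content_iff]
    rw [cachedProb, measureReal_def, measureReal_def,
      ← hseq.measure_preimage hA.nullMeasurableSet]
    rfl
  · simp only [RNDTTLCache.mem_content_iff]
    exact hseq.quasiMeasurePreserving.ae hocc
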